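/- **Notation.** For vectors $v_1,\dots,v_n$ let $\operatorname{pos}(v_1,\dots,v_n)=\{\sum_i a_iv_i: a_i\ge 0\}$. For $n\in\mathbb N$, $\lambda_0,\dots,\lambda_n\in\mathbb R\setminus\{0\}$ and $\varepsilon_1,\dots,\varepsilon_n\in\{\pm1\}$, the orthocentric cone $C_n(\lambda_0;\lambda_1,\dots,\lambda_n;\varepsilon_1,\dots,\varepsilon_n)$ is the cone, unique up to isometry, of the form $\operatorname{pos}(\varepsilon_1v_1,\dots,\varepsilon_nv_n)$, where $v_1,\dots,v_n$ are linearly independent vectors of a Euclidean space with $\langle v_i,v_j\rangle=\frac1{\lambda_0}+\frac{\delta_{ij}}{\lambda_i}$. If the matrix $\Sigma=\big(\frac1{\lambda_0}+\frac{\delta_{ij}}{\lambda_i}\big)_{i,j=1}^n$ is positive definite, put $$g_n(\lambda_0;\lambda_1,\dots,\lambda_n;\varepsilon_1,\dots,\varepsilon_n)=\mathbb P[\varepsilon_1\eta_1\le 0,\dots,\varepsilon_n\eta_n\le 0],$$ where $(\eta_1,\dots,\eta_n)$ is a centered Gaussian vector with covariance matrix $\Sigma$; for $n=0$ put $g_0(\lambda_0)=1$.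 The solid angle of a polyhedral cone $C$ is $\alpha(C)=\mathbb P[\xi\in C]$, where $\xi$ has the standard normal distribution on the linear hull of $C$. For a face $F$ of a polytope $P$, let $T(F,P)=\{v: x_0+\varepsilon v\in P\text{ for some }\varepsilon>0\}$ be the tangent cone, where $x_0$ is any point of the relative interior of $F$, and let $N(F,P)=\{v:\langle v,z\rangle\le 0\text{ for all }z\in T(F,P)\}$ be the normal cone. The internal and external angles are $\beta(F,P)=\alpha(T(F,P))$ and $\gamma(F,P)=\alpha(N(F,P))$. Finally, for $z\in\mathbb C$ let $\Phi(z)=\frac12+\frac1{\sqrt{2\pi}}\int_0^z e^{-x^2/2}\,dx$, and for $a<0$ let $\sqrt a=i\sqrt{-a}$. **Theorem 1.3 (Angles of acute orthocentric simplices).** Let $d\ge 2$, $\tau_0,\dots,\tau_d>0$, and let $e_0,\dots,e_d$ be the standard basis of $\mathbb R^{d+1}$. Let $S=[e_0/\tau_0,\dots,e_d/\tau_d]$ (convex hull), let $k\in\{0,\dots,d\}$, and let $F=[e_0/\tau_0,\dots,e_k/\tau_k]$. (a) If $k<d$, then $T(F,S)=L\oplus D$ is an orthogonal direct sum, where $L$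 is the linear space parallel to the affine hull of $F$, has dimension $k$ and is the lineality space of $T(F,S)$, and $D$ is a pointed cone (that is, $D\cap(-D)=\{0\}$) isometric to $$C_{d-k}(\tau_0^2+\dots+\tau_k^2;\ \tau_{k+1}^2,\dots,\tau_d^2;\ 1,\dots,1).$$ If $k=d$, then $T(F,S)=T(S,S)$ is the linear space parallel to the affine hull of $S$. (b) If $k<d$, then $N(F,S)$ is the orthogonal direct sum of a line through the origin and a cone isometric to $$C_{d-k}(-\tau_0^2-\dots-\tau_d^2;\ \tau_{k+1}^2,\dots,\tau_d^2;\ 1,\dots,1).$$ If $k=d$, then $N(F,S)=N(S,S)$ is a line through the origin. (c) $\beta(F,S)=g_{d-k}(-\tau_0^2-\dots-\tau_d^2;\ \tau_{k+1}^2,\dots,\tau_d^2;\ 1,\dots,1)$. (d) $\gamma(F,S)=g_{d-k}(\tau_0^2+\dots+\tau_k^2;\ \tau_{k+1}^2,\dots,\tau_d^2;\ 1,\dots,1)$. Moreover, for all $\ell\ge 0$, $\lambda_1,\dots,\lambda_\ell>0$ and $\lambda_0\in\mathbb R$ with $\lambda_0>0$ or $\lambda_0<-\lambda_1-\dots-\lambda_\ell$,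 $$g_\ell(\lambda_0;\lambda_1,\dots,\lambda_\ell;1,\dots,1)=\frac1{\sqrt{2\pi}}\int_{-\infty}^{\infty}\prod_{j=1}^{\ell}\Phi\Big(\sqrt{\tfrac{\lambda_j}{\lambda_0}}\,x\Big)e^{-x^2/2}\,dx ,$$ where the integral converges absolutely. -/

import Mathlib

open MeasureTheory ProbabilityTheory
open scoped Pointwise RealInnerProductSpace

noncomputable section

/-! ### Polyhedral cones, tangent cones, normal cones and solid angles -/

section Cones

variable {E : Type*} [NormedAddCommGroup E] [InnerProductSpace ℝ E]

/-- The tangent cone `T(F, P)`: all directions `v` such that `x₀ + ε v ∈ P` for some `ε > 0`, where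
`x₀` is a point in the relative interior of `F`. For a convex set `P` and `F ⊆ P` the choice of `x₀`
does not matter, see `mem_tangentConeOf_iff`. -/
def tangentConeOf (F P : Set E) : Set E :=
  {v | ∃ x₀ ∈ intrinsicInterior ℝ F, ∃ ε : ℝ, 0 < ε ∧ x₀ + ε • v ∈ P}

/-- The tangent cone may be computed at any point of the relative interior of `F`. -/
theorem mem_tangentConeOf_iff {F P : Set E} (hP : Convex ℝ P) (hFP : F ⊆ P) {x₀ : E}
    (hx₀ : x₀ ∈ intrinsicInterior ℝ F) (v : E) :
    v ∈ tangentConeOf F P ↔ ∃ ε : ℝ, 0 < ε ∧ x₀ + ε • v ∈ P := by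
  refine ⟨?_, fun h => ⟨x₀, hx₀, h⟩⟩
  rintro ⟨y₀, hy₀, ε, hε, hv⟩
  obtain ⟨x, hx, rfl⟩ := mem_intrinsicInterior.1 hx₀
  have hyF : y₀ ∈ affineSpan ℝ F := subset_affineSpan ℝ F (intrinsicInterior_subset hy₀)
  -- prolong the segment from `y₀` to `x₀` a little beyond `x₀`, inside `F`
  let p : ℝ → affineSpan ℝ F := fun t =>
    ⟨AffineMap.lineMap (x : E) y₀ (-t), AffineMap.lineMap_mem _ x.2 hyF⟩
  have hpc : Continuous p := by
    refine Continuous.subtype_mk ?_ _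
    simp only [AffineMap.lineMap_apply]
    fun_prop
  have hp0 : p 0 = x := by simp [p]
  have hev : ∀ᶠ t in nhds (0 : ℝ), p t ∈ ((↑) ⁻¹' F : Set (affineSpan ℝ F)) := by
    have : ((↑) ⁻¹' F : Set (affineSpan ℝ F)) ∈ nhds (p 0) := by
      rw [hp0]
      exact mem_interior_iff_mem_nhds.1 hx
    exact hpc.continuousAt this
  obtain ⟨δ, hδ, hball⟩ := Metric.eventually_nhds_iff.1 hev
  have ht : (0 : ℝ) < δ / 2 := by positivity
  have hz : ((p (δ / 2) : affineSpan ℝ F) : E) ∈ F := by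
    apply hball
    rw [Real.dist_eq, sub_zero, abs_of_pos ht]
    linarith
  set t := δ / 2 with ht_def
  have hzv : ((p t : affineSpan ℝ F) : E) = (x : E) + t • ((x : E) - y₀) := by
    simp only [p, AffineMap.lineMap_apply, vadd_eq_add, vsub_eq_sub]
    module
  have hpos : (0 : ℝ) < 1 + t := by linarith
  refine ⟨t / (1 + t) * ε, by positivity, ?_⟩
  have hcomb := hP (hFP hz) hv (a := 1 / (1 + t)) (b := t / (1 + t)) (by positivity) (by positivity)
    (by field_simp)
  rw [hzv] at hcomb
  convert hcomb using 1
  have h1 : (1 / (1 + t)) * t = t / (1 + t) := by ring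
  have h2 : (1 / (1 + t)) + t / (1 + t) = 1 := by field_simp
  calc (x : E) + (t / (1 + t) * ε) • v
      = ((1 / (1 + t)) + t / (1 + t)) • (x : E) + (t / (1 + t) * ε) • v := by rw [h2, one_smul]
    _ = _ := by
      rw [← h1]
      module

/-- The polar cone `C° = {v : ⟪v, z⟫ ≤ 0 for all z ∈ C}`. -/
def polarCone (C : Set E) : Set E :=
  {v | ∀ z ∈ C, ⟪v, z⟫ ≤ 0}

/-- The normal cone `N(F, P)`, the polar cone of the tangent cone `T(F, P)`. -/
def normalConeOf (F P : Set E) : Set E :=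
  polarCone (tangentConeOf F P)

/-- `C` is an orthocentric cone `C_n(l₀; l₁, …, lₙ; ε₁, …, εₙ)`: the positive hull of
`ε₁ v₁, …, εₙ vₙ`, where `v₁, …, vₙ` are linearly independent vectors with
`⟪vᵢ, vⱼ⟫ = 1 / l₀ + δᵢⱼ / lᵢ` for nonzero reals `l₀, …, lₙ`.
Since the Gram matrix determines `v₁, …, vₙ` up to isometry, the parameters determine the cone
up to isometry, and this predicate says that `C` is isometric to
`C_n(l₀; l₁, …, lₙ; ε₁, …, εₙ)`. -/
def IsOrthocentricCone {n : ℕ} (l₀ : ℝ) (l : Fin n → ℝ) (ε : Fin n → ℤˣ)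
    (C : PointedCone ℝ E) : Prop :=
  l₀ ≠ 0 ∧ (∀ i, l i ≠ 0) ∧
    ∃ v : Fin n → E, LinearIndependent ℝ v ∧
      (∀ i j, ⟪v i, v j⟫ = 1 / l₀ + if i = j then 1 / l i else 0) ∧
      C = PointedCone.hull ℝ (Set.range fun i => ((ε i : ℤ) : ℝ) • v i)

variable [FiniteDimensional ℝ E] [MeasurableSpace E] [BorelSpace E]

/-- The solid angle `α(C) = ℙ[ξ ∈ C]`, where `ξ` has the standard normal distribution on the linear
hull of `C`. -/
def solidAngle (C : Set E) : ℝ :=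
  (stdGaussian (Submodule.span ℝ C)).real {x | (x : E) ∈ C}

/-- The internal angle `β(F, P)`. -/
def internalAngle (F P : Set E) : ℝ := solidAngle (tangentConeOf F P)

/-- The external angle `γ(F, P)`. -/
def externalAngle (F P : Set E) : ℝ := solidAngle (normalConeOf F P)

end Cones

/-! ### The function `g` and the analytic continuation of the normal distribution function -/

/-- The matrix `(1 / l₀ + δᵢⱼ / lᵢ)ᵢⱼ`. -/
def orthoCov {n : ℕ} (l₀ : ℝ) (l : Fin n → ℝ) : Matrix (Fin n) (Fin n) ℝ :=
  Matrix.of fun i j => 1 / l₀ + if i = j then 1 / l i else 0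

/-- `g_n(l₀; l₁, …, lₙ; ε₁, …, εₙ) = ℙ[ε₁ η₁ ≤ 0, …, εₙ ηₙ ≤ 0]` for a centered Gaussian vector `η`
with covariance matrix `orthoCov l₀ l`. It is meaningful only when this matrix is positive
semidefinite. For `n = 0` the value is `1`. -/
def orthoG {n : ℕ} (l₀ : ℝ) (l : Fin n → ℝ) (ε : Fin n → ℤˣ) : ℝ :=
  (multivariateGaussian (0 : EuclideanSpace ℝ (Fin n)) (orthoCov l₀ l)).real
    {η | ∀ i, ((ε i : ℤ) : ℝ) * η i ≤ 0}

/-- `Φ(z) = 1/2 + (2π)^(-1/2) ∫₀ᶻ exp(-x²/2) dx` for complex `z`, the integral being taken along the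
segment from `0` to `z`. -/
def complexPhi (z : ℂ) : ℂ :=
  1 / 2 + 1 / (Real.sqrt (2 * Real.pi) : ℂ) *
    ∫ t in (0 : ℝ)..1, z * Complex.exp (-((t : ℂ) * z) ^ 2 / 2)

/-- The integrand `∏ⱼ Φ(√(lⱼ / l₀) x) · exp(-x²/2)`, where the square root of a negative number `a`
is `i √(-a)`. -/
def phiIntegrand {n : ℕ} (l₀ : ℝ) (l : Fin n → ℝ) (x : ℝ) : ℂ :=
  (∏ j, complexPhi (Complex.sqrt ((l j / l₀ : ℝ) : ℂ) * (x : ℂ))) *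
    Complex.exp (-(x : ℂ) ^ 2 / 2)

/-! ### The simplex `[e₀/τ₀, …, e_d/τ_d]` -/

section Simplex

variable {d : ℕ}

/-- The vertex `eᵢ / τᵢ` in `ℝ^(d+1)`. -/
def acuteVertex (τ : Fin (d + 1) → ℝ) (i : Fin (d + 1)) : EuclideanSpace ℝ (Fin (d + 1)) :=
  (τ i)⁻¹ • EuclideanSpace.single i (1 : ℝ)

/-- The simplex `[e₀/τ₀, …, e_d/τ_d]`. -/
def acuteSimplex (τ : Fin (d + 1) → ℝ) : Set (EuclideanSpace ℝ (Fin (d + 1))) :=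
  convexHull ℝ (Set.range (acuteVertex τ))

/-- The face `[e₀/τ₀, …, e_k/τ_k]`. -/
def acuteFace (τ : Fin (d + 1) → ℝ) (k : Fin (d + 1)) : Set (EuclideanSpace ℝ (Fin (d + 1))) :=
  convexHull ℝ (acuteVertex τ '' Set.Iic k)

/-- The list `τ_{k+1}², …, τ_d²`. -/
def tailSq (τ : Fin (d + 1) → ℝ) (k : Fin (d + 1)) : Fin (d - k) → ℝ :=
  fun j => τ ⟨k + 1 + j, by omega⟩ ^ 2

end Simplex

end

/-! Angles. In coordinates the simplex is `x ≥ 0`, `∑ τᵢ xᵢ = 1`, and on the relative interior of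
the face only the constraints with `i > k` are active; this gives explicit inequalities for both
cones. Modulo the directions of the face, the tangent cone is generated by the vertices beyond the
face minus the foot of the perpendicular from the origin to the affine hull of the face. Modulo the
line normal to the simplex, the normal cone is generated by the foot for the whole simplex minus
those vertices. As the vertices are pairwise orthogonal, both Gram matrices have the form
`orthoCov`. Each family of generators also cuts the other cone out of its linear hull by
inequalities `⟪uⱼ, x⟫ ≤ 0`, and Gaussian pairings have the Gram matrix as covariance
(`solidAngle_eq_orthoG`). Hence the angle of each cone carries the parameters of the other one.

Integral formula. For `l₀ > 0` one may take `ηⱼ = r ξ + ζⱼ / √lⱼ` with `r = 1 / √l₀` and independent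
standard normal `ξ, ζⱼ`; given `ξ`, the coordinates are independent and `Φ` appears. For `l₀ < 0`
the same computation is run with imaginary `r`. The conditional densities `shearKernel` are then
complex, but their average `orthoDensity` is real, because only `r² = 1 / l₀` enters, and `l₀ < -∑
lⱼ` makes the double integral converge absolutely. Characteristic functions identify the resulting
measure (`map_orthoMeasure`); `integral_Iic_cexp_neg_sq_sub` turns half-line integrals into `Φ`. -/

noncomputable section

/-! ### The complex normal distribution function as a half-line integral. -/

section GaussianIntegrals

open Complex Set Filter Topology

theorem norm_cexp_neg_sq_sub_div_two (u : ℝ) (w : ℂ) :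
    ‖cexp (-((u : ℂ) - w) ^ 2 / 2)‖ = Real.exp (-(u - w.re) ^ 2 / 2 + w.im ^ 2 / 2) := by
  rw [Complex.norm_exp]
  congr 1
  have : (-((u : ℂ) - w) ^ 2 / 2) = (((-(u - w.re) ^ 2 / 2 + w.im ^ 2 / 2 : ℝ)) : ℂ)
      + (((u - w.re) * w.im : ℝ) : ℂ) * I := by
    conv_lhs => rw [← re_add_im w]
    push_cast
    linear_combination (-(w.im : ℂ) ^ 2 / 2) * I_sq
  rw [this, add_re, re_ofReal_mul, I_re, ofReal_re, mul_zero, add_zero]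

/-- An integrable majorant in `u` that is uniform in `t`; it justifies the exchange of integrals in
`integral_Iic_cexp_neg_sq_sub`. -/
theorem norm_mul_cexp_le_of_mem_Icc {t : ℝ} (ht : t ∈ Icc (0 : ℝ) 1) (w : ℂ) (u : ℝ) :
    ‖w * ((u : ℂ) - t * w) * cexp (-((u : ℂ) - t * w) ^ 2 / 2)‖ ≤
      ‖w‖ * (|u| + ‖w‖) * (Real.exp (‖w‖ ^ 2) * Real.exp (-(1 / 4) * u ^ 2)) := by
  rw [norm_mul, norm_mul, norm_cexp_neg_sq_sub_div_two, ← Real.exp_add (‖w‖ ^ 2)]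
  have htw : ‖(t : ℂ) * w‖ ≤ ‖w‖ := by
    rw [norm_mul, norm_real, Real.norm_eq_abs, abs_of_nonneg ht.1]
    exact mul_le_of_le_one_left (norm_nonneg _) ht.2
  have h1 : ‖(u : ℂ) - t * w‖ ≤ |u| + ‖w‖ := by
    refine (norm_sub_le _ _).trans ?_
    rw [norm_real, Real.norm_eq_abs]
    gcongr
  have h2 : ((t : ℂ) * w).re ^ 2 + ((t : ℂ) * w).im ^ 2 ≤ ‖w‖ ^ 2 := by
    rw [sq, sq, ← normSq_apply, normSq_eq_norm_sq]
    gcongr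
  refine mul_le_mul (by gcongr) (Real.exp_le_exp.2 ?_) (Real.exp_pos _).le (by positivity)
  -- With `t w = a + b i`, the difference of the exponents is at least `(u - 2a)² / 4 + (a² + b²) /
  -- 2`.
  nlinarith [sq_nonneg (u - 2 * ((t : ℂ) * w).re)]

theorem integrable_abs_add_mul_exp (c : ℝ) :
    Integrable fun u : ℝ => (|u| + c) * Real.exp (-(1 / 4) * u ^ 2) := by
  have h1 : Integrable fun u : ℝ => u * Real.exp (-(1 / 4) * u ^ 2) :=
    integrable_mul_exp_neg_mul_sq (by norm_num)
  have h2 : Integrable fun u : ℝ => Real.exp (-(1 / 4) * u ^ 2) :=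
    integrable_exp_neg_mul_sq (by norm_num)
  refine (h1.norm.add (h2.const_mul c)).congr (ae_of_all _ fun u => ?_)
  simp [add_mul]

theorem integrable_cexp_neg_sq_sub (w : ℂ) :
    Integrable fun u : ℝ => cexp (-((u : ℂ) - w) ^ 2 / 2) := by
  have := integrable_cexp_quadratic (b := 1 / 2) (by norm_num) w (-w ^ 2 / 2)
  refine this.congr (ae_of_all _ fun u => ?_)
  simp only
  congr 1
  ring

theorem hasDerivAt_cexp_neg_sq_sub (c : ℂ) (u : ℝ) :
    HasDerivAt (fun u : ℝ => cexp (-((u : ℂ) - c) ^ 2 / 2))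
      (-((u : ℂ) - c) * cexp (-((u : ℂ) - c) ^ 2 / 2)) u := by
  have h := ((((hasDerivAt_id (u : ℂ)).sub_const c).pow 2).neg.div_const 2).cexp.comp_ofReal
  refine h.congr_deriv ?_
  simp only [id, Pi.neg_apply, Pi.pow_apply]
  push_cast
  ring

theorem hasDerivAt_cexp_neg_sq_sub_mul (u : ℝ) (w : ℂ) (t : ℝ) :
    HasDerivAt (fun t : ℝ => cexp (-((u : ℂ) - t * w) ^ 2 / 2))
      (w * ((u : ℂ) - t * w) * cexp (-((u : ℂ) - t * w) ^ 2 / 2)) t := by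
  have h := (((((hasDerivAt_id (t : ℂ)).mul_const w).const_sub (u : ℂ)).pow 2).neg.div_const
    2).cexp.comp_ofReal
  refine h.congr_deriv ?_
  simp only [id, Pi.neg_apply, Pi.pow_apply]
  push_cast
  ring

theorem tendsto_cexp_neg_sq_sub_atBot (w : ℂ) :
    Tendsto (fun u : ℝ => cexp (-((u : ℂ) - w) ^ 2 / 2)) atBot (𝓝 0) := by
  rw [tendsto_zero_iff_norm_tendsto_zero]
  simp_rw [norm_cexp_neg_sq_sub_div_two]
  refine Real.tendsto_exp_atBot.comp ?_
  refine tendsto_atBot_add_const_right _ _ ?_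
  have h1 : Tendsto (fun u : ℝ => u - w.re) atBot atBot :=
    tendsto_atBot_add_const_right _ _ tendsto_id
  have h2 : Tendsto (fun u : ℝ => (u - w.re) ^ 2) atBot atTop := by
    simpa [sq] using h1.atBot_mul_atBot₀ h1
  have h3 := (tendsto_neg_atTop_atBot.comp h2).atBot_div_const (r := 2) (by norm_num)
  simpa using h3

theorem integral_Iic_sub_mul_cexp (w : ℂ) (hi : IntegrableOn
      (fun u : ℝ => -((u : ℂ) - w) * cexp (-((u : ℂ) - w) ^ 2 / 2)) (Iic 0)) :
    ∫ u : ℝ in Iic 0, -((u : ℂ) - w) * cexp (-((u : ℂ) - w) ^ 2 / 2) = cexp (-w ^ 2 / 2) := by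
  rw [integral_Iic_of_hasDerivAt_of_tendsto' (fun u _ => hasDerivAt_cexp_neg_sq_sub w u) hi
    (tendsto_cexp_neg_sq_sub_atBot w)]
  simp

theorem integral_Iic_cexp_neg_sq :
    ∫ u : ℝ in Iic 0, cexp (-(u : ℂ) ^ 2 / 2) = (Real.sqrt (2 * Real.pi) : ℂ) / 2 := by
  have h := integral_gaussian_Ioi (1 / 2)
  have h2 : ∫ u : ℝ in Iic 0, Real.exp (-(1 / 2) * u ^ 2) = Real.sqrt (2 * Real.pi) / 2 := by
    have := integral_comp_neg_Iic (0 : ℝ) (fun u => Real.exp (-(1 / 2) * u ^ 2))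
    simp only [neg_zero, even_two.neg_pow] at this
    rw [this, h]
    congr 2
    ring
  rw [← ofReal_ofNat, ← ofReal_div, ← h2, ← integral_complex_ofReal]
  refine integral_congr_ae (ae_of_all _ fun u => ?_)
  simp only
  push_cast
  congr 1
  ring

/-- The complex normal distribution function as an integral over a half-line. -/
theorem integral_Iic_cexp_neg_sq_sub (w : ℂ) :
    ∫ u : ℝ in Iic 0, cexp (-((u : ℂ) - w) ^ 2 / 2) =
      (Real.sqrt (2 * Real.pi) : ℂ) * complexPhi (-w) := by
  -- `f` is the `t`-derivative of `exp(-(u - t w)² / 2)` and also `-w` times its `u`-derivative, so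
  -- the fundamental theorem of calculus evaluates the inner integral in either order.
  set f : ℝ → ℝ → ℂ := fun u t => w * ((u : ℂ) - t * w) * cexp (-((u : ℂ) - t * w) ^ 2 / 2)
  have hbound : Integrable (fun u : ℝ =>
      ‖w‖ * (|u| + ‖w‖) * (Real.exp (‖w‖ ^ 2) * Real.exp (-(1 / 4) * u ^ 2))) := by
    refine ((integrable_abs_add_mul_exp ‖w‖).const_mul (‖w‖ * Real.exp (‖w‖ ^ 2))).congr
      (ae_of_all _ fun u => ?_)
    simp only
    ring
  have hcont : Continuous (Function.uncurry f) := by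
    simp only [f, Function.uncurry_def]
    fun_prop
  have hint : Integrable (Function.uncurry f)
      ((volume.restrict (Iic 0)).prod (volume.restrict (Ioc 0 1))) := by
    have h1 : Integrable (fun p : ℝ × ℝ =>
        ‖w‖ * (|p.1| + ‖w‖) * (Real.exp (‖w‖ ^ 2) * Real.exp (-(1 / 4) * p.1 ^ 2)))
        ((volume.restrict (Iic 0)).prod (volume.restrict (Ioc 0 1))) :=
      hbound.restrict.comp_fst (volume.restrict (Ioc (0 : ℝ) 1))
    refine h1.mono' hcont.aestronglyMeasurable ?_
    rw [Measure.prod_restrict]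
    filter_upwards [ae_restrict_mem (measurableSet_Iic.prod measurableSet_Ioc)] with p hp
    exact norm_mul_cexp_le_of_mem_Icc ⟨hp.2.1.le, hp.2.2⟩ w p.1
  have hftc : ∀ u : ℝ, ∫ t in Ioc (0 : ℝ) 1, f u t =
      cexp (-((u : ℂ) - w) ^ 2 / 2) - cexp (-(u : ℂ) ^ 2 / 2) := by
    intro u
    rw [← intervalIntegral.integral_of_le zero_le_one,
      intervalIntegral.integral_eq_sub_of_hasDerivAt
        (fun t _ => hasDerivAt_cexp_neg_sq_sub_mul u w t)]
    · simp
    · apply Continuous.intervalIntegrable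
      fun_prop
  have hswap := integral_integral_swap hint
  simp_rw [hftc] at hswap
  have hi0 := integrable_cexp_neg_sq_sub 0
  simp only [sub_zero] at hi0
  rw [integral_sub (integrable_cexp_neg_sq_sub w).restrict hi0.restrict,
    integral_Iic_cexp_neg_sq] at hswap
  have hinner : ∀ t ∈ Ioc (0 : ℝ) 1, ∫ u in Iic (0 : ℝ), f u t =
      -w * cexp (-(t * w) ^ 2 / 2) := by
    intro t ht
    -- Recovering the `u`-derivative from `f` divides by `w`.
    by_cases hw : w = 0
    · simp [f, hw]
    have hft : IntegrableOn (fun u => f u t) (Iic 0) := by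
      refine (hbound.mono' (by fun_prop) (ae_of_all _ fun u => ?_)).integrableOn
      exact norm_mul_cexp_le_of_mem_Icc ⟨ht.1.le, ht.2⟩ w u
    have heq : ∀ u : ℝ, -((u : ℂ) - t * w) * cexp (-((u : ℂ) - t * w) ^ 2 / 2) =
        -w⁻¹ * f u t := by
      intro u
      simp only [f]
      field_simp
    have := integral_Iic_sub_mul_cexp (t * w) (by
      simp_rw [heq]
      exact hft.const_mul _)
    simp_rw [heq] at this
    rw [integral_const_mul] at this
    rw [← this]
    field_simp
  rw [setIntegral_congr_fun measurableSet_Ioc hinner,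
    ← intervalIntegral.integral_of_le zero_le_one, sub_eq_iff_eq_add] at hswap
  have hne : (Real.sqrt (2 * Real.pi) : ℂ) ≠ 0 := by
    rw [ofReal_ne_zero]
    positivity
  rw [hswap, complexPhi]
  simp only [mul_neg, even_two.neg_pow]
  field_simp
  ring

end GaussianIntegrals

/-! ### Gaussian mixtures with a complex shear, and the density of the orthocentric covariance. -/

section ShearedGaussian

open Complex Set Filter Topology

/-- The unnormalized density at `y` of a normal variable of variance `1 / l` with the (complex)
mean `r x`. -/
def shearKernel (l : ℝ) (r : ℂ) (x y : ℝ) : ℂ :=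
  cexp (-(l : ℂ) * ((y : ℂ) - r * x) ^ 2 / 2)

/-- For nonreal `r` the kernel grows in `x` like a Gaussian of the wrong sign. Weighing the product
of these factors against `exp(-x² / 2)` leads to the condition `(∑ j, l j) * r.im ^ 2 < 1`. -/
theorem norm_shearKernel (l : ℝ) (r : ℂ) (x y : ℝ) :
    ‖shearKernel l r x y‖ =
      Real.exp (-(l / 2) * (y - r.re * x) ^ 2) * Real.exp (l * r.im ^ 2 * x ^ 2 / 2) := by
  rw [shearKernel, Complex.norm_exp, ← Real.exp_add]
  congr 1
  have : -(l : ℂ) * ((y : ℂ) - r * x) ^ 2 / 2 =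
      ((-(l / 2) * (y - r.re * x) ^ 2 + l * r.im ^ 2 * x ^ 2 / 2 : ℝ) : ℂ)
        + ((l * (y - r.re * x) * (r.im * x) : ℝ) : ℂ) * I := by
    conv_lhs => rw [← re_add_im r]
    push_cast
    linear_combination (-(l : ℂ) * (r.im : ℂ) ^ 2 * x ^ 2 / 2) * I_sq
  rw [this, add_re, re_ofReal_mul, I_re, ofReal_re, mul_zero, add_zero]

theorem integrable_exp_neg_mul_sub_sq {l : ℝ} (hl : 0 < l) (a : ℝ) :
    Integrable fun y : ℝ => Real.exp (-(l / 2) * (y - a) ^ 2) :=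
  (integrable_exp_neg_mul_sq (half_pos hl)).comp_sub_right a

theorem integral_exp_neg_mul_sub_sq (l a : ℝ) :
    ∫ y : ℝ, Real.exp (-(l / 2) * (y - a) ^ 2) = Real.sqrt (2 * Real.pi / l) := by
  rw [integral_sub_right_eq_self (fun y : ℝ => Real.exp (-(l / 2) * y ^ 2)) a, integral_gaussian]
  congr 1
  field_simp

/-- `∫ exp(-a x² / 2 + c x + e) dx` for `a > 0`. -/
theorem integral_cexp_neg_half_sq {a : ℝ} (ha : 0 < a) (c e : ℂ) :
    ∫ x : ℝ, cexp (-(a / 2 : ℂ) * x ^ 2 + c * x + e) =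
      (Real.sqrt (2 * Real.pi / a) : ℂ) * cexp (e + c ^ 2 / (2 * a)) := by
  have hre : (-(a / 2 : ℂ)).re < 0 := by
    rw [← ofReal_ofNat, ← ofReal_div, ← ofReal_neg, ofReal_re]
    linarith
  rw [integral_cexp_quadratic hre]
  have ha' : (a : ℂ) ≠ 0 := ofReal_ne_zero.2 ha.ne'
  have h1 : (Real.pi : ℂ) / -(-(a / 2 : ℂ)) = ((2 * Real.pi / a : ℝ) : ℂ) := by
    push_cast
    field_simp
  have h2 : (Real.sqrt (2 * Real.pi / a) : ℂ) = ((2 * Real.pi / a : ℝ) : ℂ) ^ (1 / 2 : ℂ) := by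
    rw [Real.sqrt_eq_rpow, ofReal_cpow (by positivity)]
    push_cast
    rfl
  rw [h1, h2]
  congr 2
  field_simp
  ring

variable {n : ℕ}

/-- By Tonelli: the `y`-integral is a constant times `exp(-(1 - (∑ lⱼ)(Im r)²) x² / 2)`, which
decays by `hr`. -/
theorem integrable_prod_norm_shearKernel {l : Fin n → ℝ} (hl : ∀ j, 0 < l j) {r : ℂ}
    (hr : (∑ j, l j) * r.im ^ 2 < 1) :
    Integrable fun p : (Fin n → ℝ) × ℝ =>
      (∏ j, ‖shearKernel (l j) r p.2 (p.1 j)‖) * Real.exp (-p.2 ^ 2 / 2) := by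
  simp_rw [norm_shearKernel]
  refine (integrable_prod_iff' (by fun_prop)).2 ⟨ae_of_all _ fun x => ?_, ?_⟩
  · have hx : Integrable fun y : Fin n → ℝ => ∏ j, Real.exp (-(l j / 2) * (y j - r.re * x) ^ 2) *
        Real.exp (l j * r.im ^ 2 * x ^ 2 / 2) :=
      Integrable.fintype_prod (μ := fun _ => volume) (f := fun j (y : ℝ) =>
        Real.exp (-(l j / 2) * (y - r.re * x) ^ 2) * Real.exp (l j * r.im ^ 2 * x ^ 2 / 2))
        fun j => (integrable_exp_neg_mul_sub_sq (hl j) (r.re * x)).mul_const _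
    exact hx.mul_const (Real.exp (-x ^ 2 / 2))
  · have hG := (integrable_exp_neg_mul_sq (b := (1 - (∑ j, l j) * r.im ^ 2) / 2)
      (by linarith)).const_mul (∏ j, Real.sqrt (2 * Real.pi / l j))
    refine hG.congr (ae_of_all _ fun x => ?_)
    simp only
    have hnn : ∀ y : Fin n → ℝ, ‖(∏ j, Real.exp (-(l j / 2) * (y j - r.re * x) ^ 2) *
        Real.exp (l j * r.im ^ 2 * x ^ 2 / 2)) * Real.exp (-x ^ 2 / 2)‖ =
        (∏ j, Real.exp (-(l j / 2) * (y j - r.re * x) ^ 2) *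
        Real.exp (l j * r.im ^ 2 * x ^ 2 / 2)) * Real.exp (-x ^ 2 / 2) := fun y =>
      Real.norm_of_nonneg (by positivity)
    simp_rw [hnn]
    rw [integral_mul_const, integral_fintype_prod_volume_eq_prod (fun j (y : ℝ) =>
      Real.exp (-(l j / 2) * (y - r.re * x) ^ 2) * Real.exp (l j * r.im ^ 2 * x ^ 2 / 2))]
    simp_rw [integral_mul_const, integral_exp_neg_mul_sub_sq]
    rw [Finset.prod_mul_distrib, mul_assoc, ← Real.exp_sum, ← Real.exp_add]
    congr 2
    rw [← Finset.sum_div, ← Finset.sum_mul, ← Finset.sum_mul]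
    ring

theorem integrable_prod_mul_shearKernel {l : Fin n → ℝ} (hl : ∀ j, 0 < l j) {r : ℂ}
    (hr : (∑ j, l j) * r.im ^ 2 < 1) {h : Fin n → ℝ → ℂ} (hm : ∀ j, Measurable (h j))
    (hb : ∀ j y, ‖h j y‖ ≤ 1) :
    Integrable fun p : (Fin n → ℝ) × ℝ =>
      (∏ j, h j (p.1 j) * shearKernel (l j) r p.2 (p.1 j)) * cexp (-(p.2 : ℂ) ^ 2 / 2) := by
  refine (integrable_prod_norm_shearKernel hl hr).mono' ?_ (ae_of_all _ fun p => ?_)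
  · refine Measurable.aestronglyMeasurable ?_
    unfold shearKernel
    have : ∀ j, Measurable fun p : (Fin n → ℝ) × ℝ => h j (p.1 j) := fun j =>
      (hm j).comp (by fun_prop)
    fun_prop
  · rw [norm_mul, norm_prod]
    have he : ‖cexp (-(p.2 : ℂ) ^ 2 / 2)‖ = Real.exp (-p.2 ^ 2 / 2) := by
      simpa using norm_cexp_neg_sq_sub_div_two p.2 0
    rw [he]
    refine mul_le_mul_of_nonneg_right (Finset.prod_le_prod (fun j _ => norm_nonneg _)
      fun j _ => ?_) (Real.exp_pos _).le
    rw [norm_mul]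
    exact mul_le_of_le_one_left (norm_nonneg _) (hb j _)

/-- The density of the centered normal distribution with the covariance matrix `orthoCov l₀ l`. -/
def orthoDensity (l₀ : ℝ) (l : Fin n → ℝ) (y : Fin n → ℝ) : ℝ :=
  (Real.sqrt (2 * Real.pi))⁻¹ * (∏ j, Real.sqrt (l j / (2 * Real.pi))) *
    (Real.sqrt (2 * Real.pi / (1 + (∑ j, l j) / l₀)) *
      Real.exp (-(∑ j, l j * y j ^ 2) / 2 +
        (∑ j, l j * y j) ^ 2 / (2 * (1 + (∑ j, l j) / l₀) * l₀)))

theorem orthoDensity_nonneg (l₀ : ℝ) (l : Fin n → ℝ) (y : Fin n → ℝ) :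
    0 ≤ orthoDensity l₀ l y := by
  unfold orthoDensity
  positivity

theorem measurable_orthoDensity (l₀ : ℝ) (l : Fin n → ℝ) : Measurable (orthoDensity l₀ l) := by
  unfold orthoDensity
  fun_prop

/-- Complete the square in `x`. The quadratic coefficient is `1 + (∑ lⱼ) r²` and the linear one is
`r ∑ lⱼ yⱼ`, so the result involves `r` only through `r²` and is real even for imaginary `r`. -/
theorem ofReal_orthoDensity {l₀ : ℝ} {l : Fin n → ℝ} (hD : 0 < 1 + (∑ j, l j) / l₀)
    (hl₀ : l₀ ≠ 0) {r : ℂ} (hr : r ^ 2 = 1 / (l₀ : ℂ)) (y : Fin n → ℝ) :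
    (orthoDensity l₀ l y : ℂ) =
      ((Real.sqrt (2 * Real.pi))⁻¹ * (∏ j, Real.sqrt (l j / (2 * Real.pi))) : ℝ) *
        ∫ x : ℝ, (∏ j, shearKernel (l j) r x (y j)) * cexp (-(x : ℂ) ^ 2 / 2) := by
  set D : ℝ := 1 + (∑ j, l j) / l₀ with hDdef
  have hl₀' : (l₀ : ℂ) ≠ 0 := ofReal_ne_zero.2 hl₀
  have hD' : (D : ℂ) ≠ 0 := ofReal_ne_zero.2 hD.ne'
  have hDc : (D : ℂ) = 1 + (∑ j, (l j : ℂ)) * r ^ 2 := by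
    rw [hr, hDdef]
    push_cast
    ring
  have hker : ∀ x : ℝ, (∏ j, shearKernel (l j) r x (y j)) * cexp (-(x : ℂ) ^ 2 / 2) =
      cexp (-(D / 2 : ℂ) * x ^ 2 + (r * ∑ j, (l j : ℂ) * y j) * x +
        (-(∑ j, (l j : ℂ) * (y j : ℂ) ^ 2) / 2)) := by
    intro x
    unfold shearKernel
    rw [← Complex.exp_sum, ← Complex.exp_add]
    congr 1
    have hj : ∀ j, -(l j : ℂ) * ((y j : ℂ) - r * x) ^ 2 / 2 =
        (-(r ^ 2 * x ^ 2) / 2) * l j + (r * x) * (l j * y j) + (-1 / 2) * (l j * (y j : ℂ) ^ 2) :=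
      fun j => by ring
    simp_rw [hj]
    rw [Finset.sum_add_distrib, Finset.sum_add_distrib, ← Finset.mul_sum, ← Finset.mul_sum,
      ← Finset.mul_sum, hDc]
    ring
  simp_rw [hker]
  rw [integral_cexp_neg_half_sq hD, orthoDensity, ofReal_mul, ← hDdef, ofReal_mul (Real.sqrt _),
    ofReal_exp]
  congr 3
  push_cast
  rw [mul_pow, hr]
  field_simp

theorem integrable_ofReal_orthoDensity {l₀ : ℝ} {l : Fin n → ℝ} (hl : ∀ j, 0 < l j)
    (hD : 0 < 1 + (∑ j, l j) / l₀) (hl₀ : l₀ ≠ 0) {r : ℂ} (hr : r ^ 2 = 1 / (l₀ : ℂ))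
    (hri : (∑ j, l j) * r.im ^ 2 < 1) :
    Integrable (orthoDensity l₀ l) := by
  have h1 := (integrable_prod_mul_shearKernel hl hri (h := fun _ _ => 1)
    (fun _ => measurable_const) (by simp)).integral_prod_left.const_mul
    (((Real.sqrt (2 * Real.pi))⁻¹ * (∏ j, Real.sqrt (l j / (2 * Real.pi))) : ℝ) : ℂ)
  simp only [one_mul] at h1
  simp_rw [← ofReal_orthoDensity hD hl₀ hr] at h1
  simpa using h1.re

/-- The measure with density `orthoDensity`. -/
def orthoMeasure (l₀ : ℝ) (l : Fin n → ℝ) : Measure (Fin n → ℝ) :=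
  volume.withDensity fun y => ENNReal.ofReal (orthoDensity l₀ l y)

/-- For fixed `x` the kernels form a product in the `yⱼ`, so after Fubini a product function splits
into one-dimensional integrals. Characters `h` identify the measure; half-line indicators compute
`g`. -/
theorem integral_orthoMeasure {l₀ : ℝ} {l : Fin n → ℝ} (hl : ∀ j, 0 < l j)
    (hD : 0 < 1 + (∑ j, l j) / l₀) (hl₀ : l₀ ≠ 0) {r : ℂ} (hr : r ^ 2 = 1 / (l₀ : ℂ))
    (hri : (∑ j, l j) * r.im ^ 2 < 1) {h : Fin n → ℝ → ℂ} (hm : ∀ j, Measurable (h j))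
    (hb : ∀ j y, ‖h j y‖ ≤ 1) :
    ∫ y, ∏ j, h j (y j) ∂(orthoMeasure l₀ l) =
      ((Real.sqrt (2 * Real.pi))⁻¹ * (∏ j, Real.sqrt (l j / (2 * Real.pi))) : ℝ) *
        ∫ x : ℝ, (∏ j, ∫ y : ℝ, h j y * shearKernel (l j) r x y) * cexp (-(x : ℂ) ^ 2 / 2) := by
  rw [orthoMeasure, integral_withDensity_eq_integral_toReal_smul
    (measurable_orthoDensity l₀ l).ennreal_ofReal (ae_of_all _ fun _ => ENNReal.ofReal_lt_top)]
  simp_rw [ENNReal.toReal_ofReal (orthoDensity_nonneg _ _ _), Complex.real_smul,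
    ofReal_orthoDensity hD hl₀ hr, mul_assoc]
  rw [integral_const_mul]
  congr 1
  have h2 : ∀ y : Fin n → ℝ,
      (∫ x : ℝ, (∏ j, shearKernel (l j) r x (y j)) * cexp (-(x : ℂ) ^ 2 / 2)) *
        ∏ j, h j (y j) = ∫ x : ℝ, (∏ j, h j (y j) * shearKernel (l j) r x (y j)) *
          cexp (-(x : ℂ) ^ 2 / 2) := by
    intro y
    rw [← integral_mul_const]
    refine integral_congr_ae (ae_of_all _ fun x => ?_)
    simp only [Finset.prod_mul_distrib]
    ring
  simp_rw [h2]
  rw [integral_integral_swap (integrable_prod_mul_shearKernel hl hri hm hb)]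
  refine integral_congr_ae (ae_of_all _ fun x => ?_)
  simp only
  rw [integral_mul_const, integral_fintype_prod_volume_eq_prod
    (fun j (y : ℝ) => h j y * shearKernel (l j) r x y)]

theorem integrable_prod_integral_shearKernel {l : Fin n → ℝ} (hl : ∀ j, 0 < l j) {r : ℂ}
    (hri : (∑ j, l j) * r.im ^ 2 < 1) {h : Fin n → ℝ → ℂ} (hm : ∀ j, Measurable (h j))
    (hb : ∀ j y, ‖h j y‖ ≤ 1) :
    Integrable fun x : ℝ =>
      (∏ j, ∫ y : ℝ, h j y * shearKernel (l j) r x y) * cexp (-(x : ℂ) ^ 2 / 2) := by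
  refine (integrable_prod_mul_shearKernel hl hri hm hb).integral_prod_right.congr
    (ae_of_all _ fun x => ?_)
  simp only
  rw [integral_mul_const, integral_fintype_prod_volume_eq_prod
    (fun j (y : ℝ) => h j y * shearKernel (l j) r x y)]

theorem integral_cexp_mul_shearKernel {l : ℝ} (hl : 0 < l) (r : ℂ) (t x : ℝ) :
    ∫ y : ℝ, cexp (t * y * I) * shearKernel l r x y =
      (Real.sqrt (2 * Real.pi / l) : ℂ) * cexp (r * x * t * I - (t : ℂ) ^ 2 / (2 * l)) := by
  have hl' : (l : ℂ) ≠ 0 := ofReal_ne_zero.2 hl.ne'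
  have h1 : ∀ y : ℝ, cexp (t * y * I) * shearKernel l r x y =
      cexp (-(l / 2 : ℂ) * y ^ 2 + (l * (r * x) + t * I) * y + (-(l / 2 : ℂ) * (r * x) ^ 2)) := by
    intro y
    rw [shearKernel, ← Complex.exp_add]
    congr 1
    ring
  simp_rw [h1]
  rw [integral_cexp_neg_half_sq hl]
  congr 2
  field_simp
  linear_combination (t : ℂ) ^ 2 * I_sq

theorem dotProduct_orthoCov_mulVec (l₀ : ℝ) (l : Fin n → ℝ) (t : Fin n → ℝ) :
    t ⬝ᵥ (orthoCov l₀ l).mulVec t = (∑ j, t j) ^ 2 / l₀ + ∑ j, t j ^ 2 / l j := by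
  simp only [dotProduct, Matrix.mulVec, orthoCov, Matrix.of_apply, add_mul, ite_mul, zero_mul,
    Finset.sum_add_distrib, Finset.sum_ite_eq, Finset.mem_univ, if_true, mul_add]
  congr 1
  · rw [← Finset.mul_sum, ← Finset.sum_mul]
    ring
  · refine Finset.sum_congr rfl fun j _ => ?_
    ring

theorem posSemidef_orthoCov {l₀ : ℝ} {l : Fin n → ℝ} (hl : ∀ j, 0 < l j)
    (h₀ : 0 < l₀ ∨ l₀ < -∑ j, l j) : (orthoCov l₀ l).PosSemidef := by
  refine Matrix.PosSemidef.of_dotProduct_mulVec_nonneg ?_ fun t => ?_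
  · ext i j
    simp only [Matrix.conjTranspose_apply, orthoCov, Matrix.of_apply, star_trivial]
    congr 1
    by_cases hij : i = j
    · simp [hij]
    · simp [hij, Ne.symm hij]
  · rw [star_trivial, dotProduct_orthoCov_mulVec]
    have hnn : 0 ≤ ∑ j, t j ^ 2 / l j :=
      Finset.sum_nonneg fun j _ => div_nonneg (sq_nonneg _) (hl j).le
    rcases h₀ with h₀ | h₀
    · positivity
    · have hL : 0 ≤ ∑ j, l j := Finset.sum_nonneg fun j _ => (hl j).le
      -- Cauchy–Schwarz bounds the negative term `(∑ tⱼ)² / l₀`, since `∑ lⱼ < -l₀`.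
      have hcs : (∑ j, t j) ^ 2 ≤ (∑ j, l j) * ∑ j, t j ^ 2 / l j :=
        Finset.sum_sq_le_sum_mul_sum_of_sq_le_mul _ (fun j _ => (hl j).le)
          (fun j _ => div_nonneg (sq_nonneg _) (hl j).le)
          fun j _ => (mul_div_cancel₀ (t j ^ 2) (hl j).ne').ge
      have hneg : l₀ < 0 := by linarith
      have : -(∑ j, t j ^ 2 / l j) ≤ (∑ j, t j) ^ 2 / l₀ := by
        rw [le_div_iff_of_neg hneg]
        nlinarith
      linarith

theorem sqrt_mul_sqrt_two_pi_div {l : ℝ} (hl : 0 < l) :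
    Real.sqrt (l / (2 * Real.pi)) * Real.sqrt (2 * Real.pi / l) = 1 := by
  have := Real.pi_pos
  rw [← Real.sqrt_mul (by positivity)]
  convert Real.sqrt_one using 2
  field_simp

/-- The characteristic functions agree: integrating `exp(i r x ∑ tⱼ)` against the normal weight in
`x` gives `exp(-(∑ tⱼ)² / (2 l₀))`, the rank-one part of the covariance. Only finiteness of the
measure is needed beforehand; total mass one is a consequence. -/
theorem map_orthoMeasure {l₀ : ℝ} {l : Fin n → ℝ} (hl : ∀ j, 0 < l j)
    (h₀ : 0 < l₀ ∨ l₀ < -∑ j, l j) (hD : 0 < 1 + (∑ j, l j) / l₀) (hl₀ : l₀ ≠ 0) {r : ℂ}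
    (hr : r ^ 2 = 1 / (l₀ : ℂ)) (hri : (∑ j, l j) * r.im ^ 2 < 1) :
    (orthoMeasure l₀ l).map (WithLp.toLp 2) =
      multivariateGaussian (0 : EuclideanSpace ℝ (Fin n)) (orthoCov l₀ l) := by
  have hfin : IsFiniteMeasure (orthoMeasure l₀ l) :=
    isFiniteMeasure_withDensity_ofReal (integrable_ofReal_orthoDensity hl hD hl₀ hr hri).2
  refine Measure.ext_of_charFun ?_
  ext t
  rw [charFun_multivariateGaussian (posSemidef_orthoCov hl h₀), charFun_apply,
    integral_map (by fun_prop) (by fun_prop)]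
  have h1 : ∀ y : Fin n → ℝ, cexp (⟪WithLp.toLp 2 y, t⟫ * I) = ∏ j, cexp (t j * y j * I) := by
    intro y
    rw [← Complex.exp_sum, ← Finset.sum_mul]
    congr 2
    simp [PiLp.inner_apply]
  simp_rw [h1]
  rw [integral_orthoMeasure hl hD hl₀ hr hri (h := fun j y => cexp (t j * y * I))
    (fun j => by fun_prop)
    (fun j y => by rw [← ofReal_mul, norm_exp_ofReal_mul_I])]
  simp_rw [integral_cexp_mul_shearKernel (hl _)]
  have h2 : ∀ x : ℝ, (∏ j, (Real.sqrt (2 * Real.pi / l j) : ℂ) *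
      cexp (r * x * t j * I - (t j : ℂ) ^ 2 / (2 * l j))) * cexp (-(x : ℂ) ^ 2 / 2) =
      (∏ j, (Real.sqrt (2 * Real.pi / l j) : ℂ)) *
        cexp (-((1 : ℝ) / 2 : ℂ) * x ^ 2 + (r * (∑ j, (t j : ℂ)) * I) * x +
          (-(∑ j, (t j : ℂ) ^ 2 / l j) / 2)) := by
    intro x
    rw [Finset.prod_mul_distrib, mul_assoc, ← Complex.exp_sum, ← Complex.exp_add,
      Finset.sum_sub_distrib, ← Finset.sum_mul, ← Finset.mul_sum]
    congr 2
    have : ∑ j, (t j : ℂ) ^ 2 / (2 * l j) = (∑ j, (t j : ℂ) ^ 2 / l j) / 2 := by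
      rw [Finset.sum_div]
      exact Finset.sum_congr rfl fun j _ => by rw [div_div, mul_comm 2]
    rw [this]
    push_cast
    ring
  simp_rw [h2]
  rw [integral_const_mul, integral_cexp_neg_half_sq one_pos]
  have h3 : (((Real.sqrt (2 * Real.pi))⁻¹ * (∏ j, Real.sqrt (l j / (2 * Real.pi))) : ℝ) : ℂ) *
      ((∏ j, (Real.sqrt (2 * Real.pi / l j) : ℂ)) * (Real.sqrt (2 * Real.pi / 1) : ℂ)) = 1 := by
    rw [← ofReal_prod, ← ofReal_mul, ← ofReal_mul, ← ofReal_one, div_one]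
    congr 1
    have h4 : (∏ j, Real.sqrt (l j / (2 * Real.pi))) * ∏ j, Real.sqrt (2 * Real.pi / l j) = 1 := by
      rw [← Finset.prod_mul_distrib]
      exact Finset.prod_eq_one fun j _ => sqrt_mul_sqrt_two_pi_div (hl j)
    have h5 : Real.sqrt (2 * Real.pi) ≠ 0 := by positivity
    calc _ = ((∏ j, Real.sqrt (l j / (2 * Real.pi))) * ∏ j, Real.sqrt (2 * Real.pi / l j)) *
          ((Real.sqrt (2 * Real.pi))⁻¹ * Real.sqrt (2 * Real.pi)) := by ring
      _ = 1 := by rw [h4, inv_mul_cancel₀ h5, one_mul]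
  rw [← mul_assoc (∏ j, (Real.sqrt (2 * Real.pi / l j) : ℂ)), ← mul_assoc, h3, one_mul,
    dotProduct_orthoCov_mulVec]
  congr 1
  rw [mul_pow, mul_pow, hr, I_sq]
  simp only [inner_zero_right]
  push_cast
  ring

/-- The substitution `u = √l y` reduces this to `integral_Iic_cexp_neg_sq_sub`. -/
theorem integral_indicator_mul_shearKernel {l : ℝ} (hl : 0 < l) (r : ℂ) (x : ℝ) :
    ∫ y : ℝ, (Iic (0 : ℝ)).indicator (fun _ => (1 : ℂ)) y * shearKernel l r x y =
      (Real.sqrt (2 * Real.pi / l) : ℂ) * complexPhi (-((Real.sqrt l : ℂ) * r * x)) := by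
  have hs : 0 < Real.sqrt l := Real.sqrt_pos.2 hl
  have hss : (Real.sqrt l : ℂ) ^ 2 = l := by rw [← ofReal_pow, Real.sq_sqrt hl.le]
  have h1 : ∀ y : ℝ, (Iic (0 : ℝ)).indicator (fun _ => (1 : ℂ)) y * shearKernel l r x y =
      (Iic (0 : ℝ)).indicator (fun u : ℝ => cexp (-((u : ℂ) - (Real.sqrt l : ℂ) * r * x) ^ 2 / 2))
        (Real.sqrt l * y) := by
    intro y
    by_cases hy : y ≤ 0
    · rw [indicator_of_mem (by exact hy),
        indicator_of_mem (by exact mul_nonpos_of_nonneg_of_nonpos hs.le hy), one_mul, shearKernel]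
      congr 1
      rw [← hss]
      push_cast
      ring
    · rw [indicator_of_notMem (by exact hy), zero_mul, indicator_of_notMem]
      rw [mem_Iic, not_le]
      exact mul_pos hs (not_le.1 hy)
  simp_rw [h1]
  rw [Measure.integral_comp_mul_left (fun u => (Iic (0 : ℝ)).indicator
    (fun u : ℝ => cexp (-((u : ℂ) - (Real.sqrt l : ℂ) * r * x) ^ 2 / 2)) u),
    integral_indicator measurableSet_Iic, integral_Iic_cexp_neg_sq_sub, abs_of_pos (inv_pos.2 hs),
    Complex.real_smul, ← mul_assoc, Real.sqrt_div' _ hl.le]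
  push_cast
  ring

end ShearedGaussian

/-! ### The integral formula for `g`. -/

section OrthoGFormula

open Complex Set

theorem Complex.sqrt_ofReal_sq (a : ℝ) : Complex.sqrt (a : ℂ) ^ 2 = a := by
  rw [Complex.sqrt]
  exact Complex.cpow_ofNat_inv_pow _ 2

/-- A positive factor does not change the branch. Thus all the roots `√(lⱼ / l₀)` are real multiples
`√lⱼ · r` of one common `r`, as the mixture requires. -/
theorem Complex.sqrt_ofReal_mul_of_nonneg {a : ℝ} (ha : 0 ≤ a) (b : ℝ) :
    Complex.sqrt ((a * b : ℝ) : ℂ) = (Real.sqrt a : ℂ) * Complex.sqrt (b : ℂ) := by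
  rcases le_total 0 b with hb | hb
  · rw [Complex.sqrt_of_nonneg (zero_le_real.2 (mul_nonneg ha hb)),
      Complex.sqrt_of_nonneg (zero_le_real.2 hb), ofReal_re, ofReal_re, Real.sqrt_mul ha, ofReal_mul]
  · have hb' : 0 ≤ -b := neg_nonneg.2 hb
    have h1 : ((a * b : ℝ) : ℂ) = -((a * -b : ℝ) : ℂ) := by push_cast; ring
    have h2 : (b : ℂ) = -((-b : ℝ) : ℂ) := by push_cast; ring
    rw [h1, h2, Complex.sqrt_neg_of_nonneg (zero_le_real.2 (mul_nonneg ha hb')),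
      Complex.sqrt_neg_of_nonneg (zero_le_real.2 hb'),
      Complex.sqrt_of_nonneg (zero_le_real.2 (mul_nonneg ha hb')),
      Complex.sqrt_of_nonneg (zero_le_real.2 hb'), ofReal_re, ofReal_re, Real.sqrt_mul ha,
      ofReal_mul]
    ring

variable {n : ℕ}

theorem one_add_sum_div_pos {l₀ : ℝ} {l : Fin n → ℝ} (hl : ∀ j, 0 < l j)
    (h₀ : 0 < l₀ ∨ l₀ < -∑ j, l j) : 0 < 1 + (∑ j, l j) / l₀ := by
  have hL : 0 ≤ ∑ j, l j := Finset.sum_nonneg fun j _ => (hl j).le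
  rcases h₀ with h | h
  · positivity
  · have : -1 < (∑ j, l j) / l₀ := by
      rw [lt_div_iff_of_neg (by linarith)]
      linarith
    linarith

/-- As `r²` is real, `r` is real or purely imaginary. In the second case `(Im r)² = -1 / l₀`, and
the claim becomes `∑ lⱼ < -l₀`. -/
theorem sum_mul_im_sq_lt_one {l₀ : ℝ} {l : Fin n → ℝ} (hl : ∀ j, 0 < l j)
    (h₀ : 0 < l₀ ∨ l₀ < -∑ j, l j) {r : ℂ} (hr : r ^ 2 = 1 / (l₀ : ℂ)) :
    (∑ j, l j) * r.im ^ 2 < 1 := by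
  have hL : 0 ≤ ∑ j, l j := Finset.sum_nonneg fun j _ => (hl j).le
  rw [← ofReal_one, ← ofReal_div] at hr
  have hre := congrArg Complex.re hr
  have him := congrArg Complex.im hr
  rw [ofReal_re, sq, mul_re] at hre
  rw [ofReal_im, sq, mul_im] at him
  rcases eq_or_ne r.im 0 with h | h
  · simp [h]
  · have hr0 : r.re = 0 := by
      have : r.re * r.im = 0 := by linarith
      exact (mul_eq_zero.1 this).resolve_right h
    have himsq : r.im ^ 2 = -(1 / l₀) := by
      rw [hr0] at hre
      linarith
    have hpos : 0 < r.im ^ 2 := by positivity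
    rcases h₀ with h₀ | h₀
    · have : 0 < 1 / l₀ := by positivity
      linarith
    · have hneg : l₀ < 0 := by linarith
      have hmul : l₀ * r.im ^ 2 = -1 := by
        rw [himsq]
        rw [mul_neg, mul_one_div_cancel hneg.ne]
      nlinarith

theorem orthoG_one_eq_integral {l₀ : ℝ} {l : Fin n → ℝ} (hl : ∀ j, 0 < l j)
    (h₀ : 0 < l₀ ∨ l₀ < -∑ j, l j) (hD : 0 < 1 + (∑ j, l j) / l₀) (hl₀ : l₀ ≠ 0) {r : ℂ}
    (hr : r ^ 2 = 1 / (l₀ : ℂ)) (hri : (∑ j, l j) * r.im ^ 2 < 1) :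
    (orthoG l₀ l (fun _ => 1) : ℂ) =
      ∫ y, ∏ j, (Iic (0 : ℝ)).indicator (fun _ => (1 : ℂ)) (y j) ∂(orthoMeasure l₀ l) := by
  have hS : MeasurableSet {y : Fin n → ℝ | ∀ j, y j ≤ 0} := by
    rw [ofPred_forall]
    exact MeasurableSet.iInter fun j => measurableSet_le (by fun_prop) measurable_const
  have hS' : MeasurableSet {η : EuclideanSpace ℝ (Fin n) | ∀ j, η j ≤ 0} := by
    rw [ofPred_forall]
    exact MeasurableSet.iInter fun j => measurableSet_le (by fun_prop) measurable_const
  have hind : ∀ y : Fin n → ℝ, ∏ j, (Iic (0 : ℝ)).indicator (fun _ => (1 : ℂ)) (y j) =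
      {y : Fin n → ℝ | ∀ j, y j ≤ 0}.indicator (fun _ => (1 : ℂ)) y := by
    intro y
    by_cases hy : ∀ j, y j ≤ 0
    · rw [indicator_of_mem (by exact hy)]
      exact Finset.prod_eq_one fun j _ => indicator_of_mem (by exact hy j) _
    · rw [indicator_of_notMem (by exact hy)]
      push Not at hy
      obtain ⟨j, hj⟩ := hy
      exact Finset.prod_eq_zero (Finset.mem_univ j) (indicator_of_notMem (by simpa using hj) _)
  simp_rw [hind]
  rw [integral_indicator hS, setIntegral_const, Complex.real_smul, mul_one, orthoG,
    ← map_orthoMeasure hl h₀ hD hl₀ hr hri]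
  simp only [Units.val_one, Int.cast_one, one_mul]
  rw [map_measureReal_apply (by fun_prop) hS']
  rfl

theorem integrable_phiIntegrand_and_orthoG_eq {l₀ : ℝ} {l : Fin n → ℝ} (hl : ∀ j, 0 < l j)
    (h₀ : 0 < l₀ ∨ l₀ < -∑ j, l j) :
    Integrable (phiIntegrand l₀ l) ∧
      (orthoG l₀ l (fun _ => 1) : ℂ) =
        1 / (Real.sqrt (2 * Real.pi) : ℂ) * ∫ x : ℝ, phiIntegrand l₀ l x := by
  have hL : 0 ≤ ∑ j, l j := Finset.sum_nonneg fun j _ => (hl j).le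
  have hl₀ : l₀ ≠ 0 := by
    rcases h₀ with h | h
    · exact h.ne'
    · linarith
  set r : ℂ := Complex.sqrt ((1 / l₀ : ℝ) : ℂ) with hrdef
  have hr : r ^ 2 = 1 / (l₀ : ℂ) := by
    rw [hrdef, Complex.sqrt_ofReal_sq]
    push_cast
    rfl
  have hD := one_add_sum_div_pos hl h₀
  have hri := sum_mul_im_sq_lt_one hl h₀ hr
  have hm : ∀ _ : Fin n, Measurable ((Iic (0 : ℝ)).indicator fun _ => (1 : ℂ)) := fun _ =>
    measurable_const.indicator measurableSet_Iic
  have hb : ∀ (_ : Fin n) (y : ℝ), ‖(Iic (0 : ℝ)).indicator (fun _ => (1 : ℂ)) y‖ ≤ 1 := fun _ y =>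
    (norm_indicator_le_norm_self _ _).trans (by simp)
  -- Integrating out `y` gives `Φ(-√lⱼ r x)`, hence the integrand at `-x`; both parts of the
  -- conclusion undo the reflection.
  have hphi : ∀ x : ℝ,
      (∏ j, ∫ y : ℝ, (Iic (0 : ℝ)).indicator (fun _ => (1 : ℂ)) y * shearKernel (l j) r x y) *
        cexp (-(x : ℂ) ^ 2 / 2) =
      (∏ j, (Real.sqrt (2 * Real.pi / l j) : ℂ)) * phiIntegrand l₀ l (-x) := by
    intro x
    simp_rw [integral_indicator_mul_shearKernel (hl _)]
    rw [Finset.prod_mul_distrib, mul_assoc, phiIntegrand]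
    congr 2
    · refine Finset.prod_congr rfl fun j _ => ?_
      rw [div_eq_mul_one_div (l j) l₀, Complex.sqrt_ofReal_mul_of_nonneg (hl j).le]
      push_cast
      congr 1
      simp only [hrdef]
      push_cast
      ring
    · simp
  have hne : ∏ j, (Real.sqrt (2 * Real.pi / l j) : ℂ) ≠ 0 := by
    refine Finset.prod_ne_zero_iff.2 fun j _ => ofReal_ne_zero.2 ?_
    have := hl j
    have := Real.pi_pos
    positivity
  constructor
  · have h1 := integrable_prod_integral_shearKernel hl hri hm hb
    simp_rw [hphi] at h1
    have h2 := (h1.const_mul (∏ j, (Real.sqrt (2 * Real.pi / l j) : ℂ))⁻¹).comp_neg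
    simpa only [neg_neg, inv_mul_cancel_left₀ hne] using h2
  · rw [orthoG_one_eq_integral hl h₀ hD hl₀ hr hri, integral_orthoMeasure hl hD hl₀ hr hri hm hb]
    simp_rw [hphi]
    rw [integral_const_mul, integral_neg_eq_self, ← mul_assoc]
    congr 1
    rw [ofReal_mul, ofReal_prod, mul_assoc, ← Finset.prod_mul_distrib,
      Finset.prod_eq_one fun j _ => ?_, mul_one]
    · push_cast
      rw [one_div]
    · rw [← ofReal_mul, sqrt_mul_sqrt_two_pi_div (hl j), ofReal_one]

end OrthoGFormula

/-! ### Solid angles as Gaussian orthant probabilities. -/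

section SolidAngle

variable {E : Type*} [NormedAddCommGroup E] [InnerProductSpace ℝ E] [FiniteDimensional ℝ E]
  [MeasurableSpace E] [BorelSpace E] {n : ℕ}

/-- The characteristic function of the pairings at `t` is that of `stdGaussian` at `∑ tⱼ uⱼ`, whose
squared norm is the Gram form of `t`. -/
theorem map_inner_stdGaussian {l₀ : ℝ} {l : Fin n → ℝ} {u : Fin n → E}
    (hu : ∀ i j, ⟪u i, u j⟫ = orthoCov l₀ l i j) :
    (stdGaussian E).map (fun x => WithLp.toLp 2 fun j => ⟪u j, x⟫) =
      multivariateGaussian (0 : EuclideanSpace ℝ (Fin n)) (orthoCov l₀ l) := by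
  have hpsd : (orthoCov l₀ l).PosSemidef := by
    have : orthoCov l₀ l = Matrix.gram ℝ u := by
      ext i j
      rw [Matrix.gram_apply, hu]
    rw [this]
    exact Matrix.posSemidef_gram ℝ u
  have hmeas : Measurable fun x : E => WithLp.toLp 2 fun j => ⟪u j, x⟫ := by fun_prop
  have := Measure.isFiniteMeasure_map (stdGaussian E)
    (fun x : E => WithLp.toLp 2 fun j => ⟪u j, x⟫)
  refine Measure.ext_of_charFun ?_
  ext t
  rw [charFun_multivariateGaussian hpsd, charFun_apply,
    integral_map hmeas.aemeasurable (by fun_prop)]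
  have h1 : ∀ x : E, ⟪WithLp.toLp 2 fun j => ⟪u j, x⟫, t⟫ = ⟪x, ∑ j, t j • u j⟫ := by
    intro x
    simp only [PiLp.inner_apply, inner_sum, inner_smul_right, real_inner_comm x]
    simp
  simp_rw [h1]
  rw [← charFun_apply, charFun_stdGaussian]
  congr 1
  have h2 : ‖∑ j, t j • u j‖ ^ 2 = t.ofLp ⬝ᵥ (orthoCov l₀ l).mulVec t.ofLp := by
    rw [← real_inner_self_eq_norm_sq, sum_inner]
    simp only [inner_sum, inner_smul_right, inner_smul_left, hu, dotProduct, Matrix.mulVec,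
      RCLike.conj_to_real, Finset.mul_sum]
    refine Finset.sum_congr rfl fun i _ => Finset.sum_congr rfl fun j _ => ?_
    ring
  rw [← h2, inner_zero_right]
  push_cast
  ring

/-- The solid angle of a cone cut out from its linear hull by the inequalities `⟪uⱼ, x⟫ ≤ 0`. -/
theorem solidAngle_eq_orthoG {l₀ : ℝ} {l : Fin n → ℝ}
    {C : Set E} {u : Fin n → E} (huC : ∀ j, u j ∈ Submodule.span ℝ C)
    (hu : ∀ i j, ⟪u i, u j⟫ = orthoCov l₀ l i j)
    (hC : ∀ x ∈ Submodule.span ℝ C, x ∈ C ↔ ∀ j, ⟪u j, x⟫ ≤ 0) :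
    solidAngle C = orthoG l₀ l (fun _ => 1) := by
  have hS : MeasurableSet {η : EuclideanSpace ℝ (Fin n) | ∀ j, η j ≤ 0} := by
    rw [Set.ofPred_forall]
    exact MeasurableSet.iInter fun j => measurableSet_le (by fun_prop) measurable_const
  -- The normal distribution lives on the linear hull of `C`, so the `uⱼ` must lie there for their
  -- Gram matrix to be the covariance.
  have hmap := map_inner_stdGaussian (u := fun j => (⟨u j, huC j⟩ : Submodule.span ℝ C))
    fun i j => hu i j
  rw [solidAngle, orthoG, ← hmap]
  simp only [Units.val_one, Int.cast_one, one_mul]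
  rw [map_measureReal_apply (by fun_prop) hS]
  congr 1
  ext x
  exact hC x x.2

end SolidAngle

/-! ### Relative interiors and positive hulls. -/

section RelativeInterior

variable {E : Type*} [NormedAddCommGroup E] [NormedSpace ℝ E]

/-- A segment ending in the relative interior of `F` can be prolonged inside `F`. -/
theorem exists_pos_add_smul_sub_mem {F : Set E} {x b : E} (hx : x ∈ intrinsicInterior ℝ F)
    (hb : b ∈ F) : ∃ t : ℝ, 0 < t ∧ x + t • (x - b) ∈ F := by
  obtain ⟨x, hxi, rfl⟩ := mem_intrinsicInterior.1 hx
  have hbF : b ∈ affineSpan ℝ F := subset_affineSpan ℝ F hb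
  let p : ℝ → affineSpan ℝ F := fun t =>
    ⟨AffineMap.lineMap (x : E) b (-t), AffineMap.lineMap_mem _ x.2 hbF⟩
  have hpc : Continuous p := by
    refine Continuous.subtype_mk ?_ _
    simp only [AffineMap.lineMap_apply]
    fun_prop
  have hp0 : p 0 = x := by simp [p]
  have hev : ∀ᶠ t in nhds (0 : ℝ), p t ∈ ((↑) ⁻¹' F : Set (affineSpan ℝ F)) := by
    have : ((↑) ⁻¹' F : Set (affineSpan ℝ F)) ∈ nhds (p 0) := by
      rw [hp0]
      exact mem_interior_iff_mem_nhds.1 hxi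
    exact hpc.continuousAt this
  obtain ⟨t, ht, ht0⟩ := ((hev.filter_mono nhdsWithin_le_nhds).and
    (self_mem_nhdsWithin (s := Set.Ioi (0 : ℝ)))).exists
  refine ⟨t, ht0, ?_⟩
  have heq : (x : E) + t • ((x : E) - b) = (p t : E) := by
    simp only [p, AffineMap.lineMap_apply, vadd_eq_add, vsub_eq_sub]
    module
  rw [heq]
  exact ht

end RelativeInterior

section Hull

variable {E : Type*} [AddCommGroup E] [Module ℝ E]

theorem PointedCone.mem_hull_range_iff {ι : Type*} [Fintype ι] {v : ι → E} {x : E} :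
    x ∈ PointedCone.hull ℝ (Set.range v) ↔ ∃ c : ι → ℝ, (∀ i, 0 ≤ c i) ∧ ∑ i, c i • v i = x := by
  rw [PointedCone.hull, Submodule.mem_span_range_iff_exists_fun]
  constructor
  · rintro ⟨c, hc⟩
    exact ⟨fun i => c i, fun i => (c i).2, hc⟩
  · rintro ⟨c, hc0, hc⟩
    exact ⟨fun i => ⟨c i, hc0 i⟩, hc⟩

end Hull

/-! ### The simplex, its tangent cones and its normal cones in coordinates. -/

section Simplex

variable {d : ℕ}

local notation "𝔼" => EuclideanSpace ℝ (Fin (d + 1))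

theorem acuteVertex_apply (τ : Fin (d + 1) → ℝ) (i j : Fin (d + 1)) :
    acuteVertex τ i j = if j = i then (τ i)⁻¹ else 0 := by
  simp [acuteVertex]

theorem inner_acuteVertex (τ : Fin (d + 1) → ℝ) (i : Fin (d + 1)) (x : 𝔼) :
    ⟪acuteVertex τ i, x⟫ = (τ i)⁻¹ * x i := by
  simp [acuteVertex, inner_smul_left, EuclideanSpace.inner_single_left]

/-- The linear functional `x ↦ ∑ τᵢ xᵢ`, which takes the value `1` at all vertices. -/
def weightSum (τ : Fin (d + 1) → ℝ) : 𝔼 →ₗ[ℝ] ℝ :=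
  ∑ i, τ i • (EuclideanSpace.proj i : 𝔼 →L[ℝ] ℝ).toLinearMap

theorem weightSum_apply (τ : Fin (d + 1) → ℝ) (x : 𝔼) : weightSum τ x = ∑ i, τ i * x i := by
  simp [weightSum]

variable {τ : Fin (d + 1) → ℝ} (hτ : ∀ i, 0 < τ i)
include hτ

theorem weightSum_acuteVertex (i : Fin (d + 1)) : weightSum τ (acuteVertex τ i) = 1 := by
  have := (hτ i).ne'
  simp [weightSum_apply, acuteVertex_apply, this]

/-- The numbers `τᵢ xᵢ` act as barycentric coordinates. -/
theorem sum_smul_acuteVertex (x : 𝔼) : ∑ i, (τ i * x i) • acuteVertex τ i = x := by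
  ext j
  have := (hτ j).ne'
  simp only [WithLp.ofLp_sum, Finset.sum_apply, PiLp.smul_apply, acuteVertex_apply, smul_eq_mul,
    mul_ite, mul_zero, Finset.sum_ite_eq, Finset.mem_univ, if_true]
  field_simp

theorem mem_acuteSimplex_iff {x : 𝔼} :
    x ∈ acuteSimplex τ ↔ (∀ i, 0 ≤ x i) ∧ weightSum τ x = 1 := by
  constructor
  · intro hx
    have hc : Convex ℝ {x : 𝔼 | (∀ i, 0 ≤ x i) ∧ weightSum τ x = 1} := by
      rintro x ⟨hx0, hx1⟩ y ⟨hy0, hy1⟩ a b ha hb hab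
      refine ⟨fun i => ?_, ?_⟩
      · simp only [PiLp.add_apply, PiLp.smul_apply, smul_eq_mul]
        have := hx0 i
        have := hy0 i
        positivity
      · simp [hx1, hy1, hab]
    refine convexHull_min ?_ hc hx
    rintro _ ⟨i, rfl⟩
    refine ⟨fun j => ?_, weightSum_acuteVertex hτ i⟩
    rw [acuteVertex_apply]
    split_ifs
    · exact (inv_pos.2 (hτ i)).le
    · exact le_rfl
  · rintro ⟨h0, h1⟩
    rw [← sum_smul_acuteVertex hτ x]
    refine (convex_convexHull ℝ _).sum_mem (fun i _ => mul_nonneg (hτ i).le (h0 i)) ?_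
      fun i _ => subset_convexHull ℝ _ ⟨i, rfl⟩
    rw [← h1, weightSum_apply]

omit hτ in
theorem acuteVertex_mem_acuteFace {i k : Fin (d + 1)} (hik : i ≤ k) :
    acuteVertex τ i ∈ acuteFace τ k :=
  subset_convexHull ℝ _ ⟨i, hik, rfl⟩

omit hτ in
theorem acuteFace_subset_acuteSimplex (k : Fin (d + 1)) : acuteFace τ k ⊆ acuteSimplex τ :=
  convexHull_mono (Set.image_subset_range _ _)

omit hτ in
theorem apply_eq_zero_of_mem_acuteFace {k : Fin (d + 1)} {x : 𝔼} (hx : x ∈ acuteFace τ k)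
    {i : Fin (d + 1)} (hi : k < i) : x i = 0 := by
  have hc : Convex ℝ {x : 𝔼 | x i = 0} := by
    intro x hx y hy a b _ _ _
    simp only [Set.mem_ofPred_eq] at hx hy
    simp [hx, hy]
  refine convexHull_min ?_ hc hx
  rintro _ ⟨j, hj, rfl⟩
  simp only [Set.mem_ofPred_eq]
  rw [acuteVertex_apply, if_neg]
  rintro rfl
  exact absurd hi (not_lt.2 hj)

/-- Prolong the segment from vertex `i` slightly beyond `x` inside the face. Nonnegativity of
coordinate `i` at the new point forces it to be positive at `x`. -/
theorem apply_pos_of_mem_intrinsicInterior {k : Fin (d + 1)} {x : 𝔼}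
    (hx : x ∈ intrinsicInterior ℝ (acuteFace τ k)) {i : Fin (d + 1)} (hi : i ≤ k) : 0 < x i := by
  obtain ⟨t, ht, hxt⟩ := exists_pos_add_smul_sub_mem hx (acuteVertex_mem_acuteFace hi)
  have h := ((mem_acuteSimplex_iff hτ).1 (acuteFace_subset_acuteSimplex k hxt)).1 i
  simp only [PiLp.add_apply, PiLp.smul_apply, PiLp.sub_apply, smul_eq_mul, acuteVertex_apply,
    if_true] at h
  have h1 : 0 < t * (τ i)⁻¹ := mul_pos ht (inv_pos.2 (hτ i))
  have h2 : 0 < (1 + t) * x i := by linarith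
  exact pos_of_mul_pos_right h2 (by linarith)

theorem mem_tangentConeOf_acuteFace_iff {k : Fin (d + 1)} {v : 𝔼} :
    v ∈ tangentConeOf (acuteFace τ k) (acuteSimplex τ) ↔
      weightSum τ v = 0 ∧ ∀ i, k < i → 0 ≤ v i := by
  constructor
  · rintro ⟨x, hx, ε, hε, h⟩
    have hxF := intrinsicInterior_subset hx
    have hxS := (mem_acuteSimplex_iff hτ).1 (acuteFace_subset_acuteSimplex k hxF)
    obtain ⟨h0, h1⟩ := (mem_acuteSimplex_iff hτ).1 h
    constructor
    · rw [map_add, map_smul, hxS.2, smul_eq_mul] at h1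
      have : ε * weightSum τ v = 0 := by linarith
      exact (mul_eq_zero.1 this).resolve_left hε.ne'
    · intro i hi
      have := h0 i
      simp only [PiLp.add_apply, PiLp.smul_apply, smul_eq_mul,
        apply_eq_zero_of_mem_acuteFace hxF hi, zero_add] at this
      exact nonneg_of_mul_nonneg_right this hε
  · rintro ⟨h0, h1⟩
    obtain ⟨x, hx⟩ := Set.Nonempty.intrinsicInterior (convex_convexHull ℝ _)
      ⟨_, acuteVertex_mem_acuteFace (τ := τ) (le_refl k)⟩
    have hxF := intrinsicInterior_subset hx
    have hxS := (mem_acuteSimplex_iff hτ).1 (acuteFace_subset_acuteSimplex k hxF)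
    -- Coordinates up to `k` are positive at `x` and survive a small step by continuity; the others
    -- only increase or stay.
    have hev : ∀ᶠ ε : ℝ in nhdsWithin 0 (Set.Ioi 0), ∀ i, 0 ≤ x i + ε * v i := by
      refine Filter.eventually_all.2 fun i => ?_
      rcases le_or_gt i k with hi | hi
      · have hpos := apply_pos_of_mem_intrinsicInterior hτ hx hi
        have hc : Filter.Tendsto (fun ε : ℝ => x i + ε * v i) (nhds 0) (nhds (x i)) := by
          have : Continuous fun ε : ℝ => x i + ε * v i := by fun_prop
          simpa using this.tendsto 0
        exact ((hc.eventually (lt_mem_nhds hpos)).filter_mono nhdsWithin_le_nhds).mono fun _ h => h.le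
      · filter_upwards [self_mem_nhdsWithin] with ε hε
        exact add_nonneg (hxS.1 i) (mul_nonneg (le_of_lt hε) (h1 i hi))
    obtain ⟨ε, hε, hε0⟩ := (hev.and self_mem_nhdsWithin).exists
    refine ⟨x, hx, ε, hε0, (mem_acuteSimplex_iff hτ).2 ⟨fun i => ?_, ?_⟩⟩
    · simpa using hε i
    · rw [map_add, map_smul, hxS.2, h0, smul_zero, add_zero]

/-- Expansion in the edge vectors at vertex `0`, which lies in every face considered and so serves
as base point for all `k`. -/
theorem sum_smul_acuteVertex_sub {x : 𝔼} (hx : weightSum τ x = 0) :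
    ∑ i, (τ i * x i) • (acuteVertex τ i - acuteVertex τ 0) = x := by
  simp_rw [smul_sub]
  rw [Finset.sum_sub_distrib, sum_smul_acuteVertex hτ, ← Finset.sum_smul, ← weightSum_apply, hx,
    zero_smul, sub_zero]

theorem mem_vectorSpan_acuteFace_iff {k : Fin (d + 1)} {v : 𝔼} :
    v ∈ vectorSpan ℝ (acuteFace τ k) ↔ weightSum τ v = 0 ∧ ∀ i, k < i → v i = 0 := by
  constructor
  · intro hv
    rw [vectorSpan_def] at hv
    induction hv using Submodule.span_induction with
    | mem x hx =>
      obtain ⟨y, hy, z, hz, rfl⟩ := hx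
      have hyS := (mem_acuteSimplex_iff hτ).1 (acuteFace_subset_acuteSimplex k hy)
      have hzS := (mem_acuteSimplex_iff hτ).1 (acuteFace_subset_acuteSimplex k hz)
      refine ⟨by simp [hyS.2, hzS.2], fun i hi => ?_⟩
      simp [apply_eq_zero_of_mem_acuteFace hy hi, apply_eq_zero_of_mem_acuteFace hz hi]
    | zero => simp
    | add x y _ _ hx hy =>
      exact ⟨by simp [hx.1, hy.1], fun i hi => by simp [hx.2 i hi, hy.2 i hi]⟩
    | smul a x _ hx => exact ⟨by simp [hx.1], fun i hi => by simp [hx.2 i hi]⟩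
  · rintro ⟨h0, h1⟩
    rw [← sum_smul_acuteVertex_sub hτ h0]
    refine Submodule.sum_mem _ fun i _ => ?_
    rcases le_or_gt i k with hi | hi
    · exact Submodule.smul_mem _ _ (vsub_mem_vectorSpan ℝ (acuteVertex_mem_acuteFace hi)
        (acuteVertex_mem_acuteFace (Fin.zero_le k)))
    · rw [h1 i hi, mul_zero, zero_smul]
      exact Submodule.zero_mem _

theorem linearIndependent_acuteVertex : LinearIndependent ℝ (acuteVertex τ) := by
  rw [Fintype.linearIndependent_iff]
  intro g hg i
  have h := congrArg (fun x : 𝔼 => x i) hg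
  simpa [acuteVertex_apply, (hτ i).ne'] using h

theorem finrank_vectorSpan_acuteFace (k : Fin (d + 1)) :
    Module.finrank ℝ (vectorSpan ℝ (acuteFace τ k)) = k := by
  have h := (linearIndependent_acuteVertex hτ).affineIndependent.finrank_vectorSpan_image_finset
    (s := Finset.Iic k) (n := k) (by simp)
  rw [acuteFace, ← direction_affineSpan, affineSpan_convexHull, direction_affineSpan]
  rwa [Finset.coe_image, Finset.coe_Iic] at h

/-- The edge vectors from vertex `0` lie in the tangent cone, with both signs for `i ≤ k`, and
testing on them suffices by `sum_smul_acuteVertex_sub`. -/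
theorem mem_normalConeOf_acuteFace_iff {k : Fin (d + 1)} {x : 𝔼} :
    x ∈ normalConeOf (acuteFace τ k) (acuteSimplex τ) ↔
      (∀ i ≤ k, (τ i)⁻¹ * x i = (τ 0)⁻¹ * x 0) ∧ ∀ i, k < i → (τ i)⁻¹ * x i ≤ (τ 0)⁻¹ * x 0 := by
  have hdiff : ∀ i, ⟪x, acuteVertex τ i - acuteVertex τ 0⟫ = (τ i)⁻¹ * x i - (τ 0)⁻¹ * x 0 := by
    intro i
    rw [real_inner_comm, inner_sub_left, inner_acuteVertex, inner_acuteVertex]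
  constructor
  · intro hx
    have hle : ∀ i, (τ i)⁻¹ * x i ≤ (τ 0)⁻¹ * x 0 := by
      intro i
      have := hx (acuteVertex τ i - acuteVertex τ 0) ((mem_tangentConeOf_acuteFace_iff hτ).2
        ⟨by simp [weightSum_acuteVertex hτ], fun j hj => by
          have hj0 : j ≠ 0 := (lt_of_le_of_lt (Fin.zero_le k) hj).ne'
          have := (inv_pos.2 (hτ i)).le
          simp only [PiLp.sub_apply, acuteVertex_apply, hj0, if_false, sub_zero]
          split_ifs
          · exact this
          · exact le_rfl⟩)
      rw [hdiff] at this
      linarith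
    refine ⟨fun i hi => le_antisymm (hle i) ?_, fun i _ => hle i⟩
    have := hx (-(acuteVertex τ i - acuteVertex τ 0)) ((mem_tangentConeOf_acuteFace_iff hτ).2
        ⟨by simp [weightSum_acuteVertex hτ], fun j hj => by
          have hj0 : j ≠ 0 := (lt_of_le_of_lt (Fin.zero_le k) hj).ne'
          have hji : j ≠ i := (lt_of_le_of_lt hi hj).ne'
          simp [acuteVertex_apply, hj0, hji]⟩)
    rw [inner_neg_right, hdiff] at this
    linarith
  · rintro ⟨h0, h1⟩ v hv
    obtain ⟨hv0, hv1⟩ := (mem_tangentConeOf_acuteFace_iff hτ).1 hv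
    rw [← sum_smul_acuteVertex_sub hτ hv0, inner_sum]
    refine Finset.sum_nonpos fun i _ => ?_
    rw [inner_smul_right, hdiff]
    rcases le_or_gt i k with hi | hi
    · rw [h0 i hi, sub_self, mul_zero]
    · exact mul_nonpos_of_nonneg_of_nonpos (mul_nonneg (hτ i).le (hv1 i hi))
        (sub_nonpos.2 (h1 i hi))

end Simplex

/-! ### Generators of the two cones, their Gram matrices, and the angles. -/

section SimplexCones

variable {d : ℕ}

local notation "𝔼" => EuclideanSpace ℝ (Fin (d + 1))

/-- The index `k + 1 + j` of the vertices outside of the face `[e₀/τ₀, …, e_k/τ_k]`. -/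
def tailIndex (k : Fin (d + 1)) (j : Fin (d - k)) : Fin (d + 1) :=
  ⟨k + 1 + j, by omega⟩

theorem tailSq_eq (τ : Fin (d + 1) → ℝ) (k : Fin (d + 1)) (j : Fin (d - k)) :
    tailSq τ k j = τ (tailIndex k j) ^ 2 := rfl

theorem lt_tailIndex (k : Fin (d + 1)) (j : Fin (d - k)) : k < tailIndex k j := by
  rw [Fin.lt_def, tailIndex]
  simp only
  omega

theorem tailIndex_inj {k : Fin (d + 1)} {i j : Fin (d - k)} :
    tailIndex k i = tailIndex k j ↔ i = j := by
  simp [tailIndex, Fin.ext_iff]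

theorem exists_tailIndex_eq {k i : Fin (d + 1)} (hi : k < i) : ∃ j, tailIndex k j = i := by
  rw [Fin.lt_def] at hi
  exact ⟨⟨i - k - 1, by omega⟩, Fin.ext (by simp only [tailIndex]; omega)⟩

theorem forall_gt_iff_tailIndex {k : Fin (d + 1)} {p : Fin (d + 1) → Prop} :
    (∀ i, k < i → p i) ↔ ∀ j, p (tailIndex k j) := by
  refine ⟨fun h j => h _ (lt_tailIndex k j), fun h i hi => ?_⟩
  obtain ⟨j, rfl⟩ := exists_tailIndex_eq hi
  exact h j

/-- The vector with the coordinates `τᵢ`, `i ∈ s`, and `0` otherwise. -/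
def restrictVec (τ : Fin (d + 1) → ℝ) (s : Finset (Fin (d + 1))) : 𝔼 :=
  WithLp.toLp 2 fun i => if i ∈ s then τ i else 0

theorem restrictVec_apply (τ : Fin (d + 1) → ℝ) (s : Finset (Fin (d + 1))) (i : Fin (d + 1)) :
    restrictVec τ s i = if i ∈ s then τ i else 0 := rfl

theorem inner_restrictVec (τ : Fin (d + 1) → ℝ) (s : Finset (Fin (d + 1))) (x : 𝔼) :
    ⟪restrictVec τ s, x⟫ = ∑ i ∈ s, τ i * x i := by
  simp [PiLp.inner_apply, restrictVec_apply, mul_comm]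

theorem inner_restrictVec_self (τ : Fin (d + 1) → ℝ) (s : Finset (Fin (d + 1))) :
    ⟪restrictVec τ s, restrictVec τ s⟫ = ∑ i ∈ s, τ i ^ 2 := by
  rw [inner_restrictVec]
  exact Finset.sum_congr rfl fun i hi => by rw [restrictVec_apply, if_pos hi, sq]

theorem inner_restrictVec_univ (τ : Fin (d + 1) → ℝ) (x : 𝔼) :
    ⟪restrictVec τ Finset.univ, x⟫ = weightSum τ x := by
  rw [inner_restrictVec, weightSum_apply]

/-- The generators of the pointed part of the tangent cone: the components of the remaining
vertices orthogonal to the linear hull of the face. -/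
def tangentGenerator (τ : Fin (d + 1) → ℝ) (k : Fin (d + 1)) (j : Fin (d - k)) : 𝔼 :=
  acuteVertex τ (tailIndex k j) - (∑ i ∈ Finset.Iic k, τ i ^ 2)⁻¹ • restrictVec τ (Finset.Iic k)

/-- The generators of the pointed part of the normal cone. -/
def normalGenerator (τ : Fin (d + 1) → ℝ) (k : Fin (d + 1)) (j : Fin (d - k)) : 𝔼 :=
  (∑ i, τ i ^ 2)⁻¹ • restrictVec τ Finset.univ - acuteVertex τ (tailIndex k j)

variable {τ : Fin (d + 1) → ℝ}

/-- The foot of the perpendicular is supported on the face, so the coordinates beyond `k` read off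
the coefficients of a combination of generators. Independence, salience and the decomposition of the
tangent cone rest on this. -/
theorem tangentGenerator_tailIndex {k : Fin (d + 1)} (i j : Fin (d - k)) :
    tangentGenerator τ k j (tailIndex k i) = if i = j then (τ (tailIndex k j))⁻¹ else 0 := by
  simp [tangentGenerator, restrictVec_apply, acuteVertex_apply, tailIndex_inj,
    not_le.2 (lt_tailIndex k i)]

theorem sum_smul_tangentGenerator_tailIndex {k : Fin (d + 1)} (c : Fin (d - k) → ℝ)
    (i : Fin (d - k)) :
    (∑ j, c j • tangentGenerator τ k j) (tailIndex k i) = c i * (τ (tailIndex k i))⁻¹ := by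
  simp [tangentGenerator_tailIndex]

theorem normalGenerator_zero {k : Fin (d + 1)} (j : Fin (d - k)) :
    normalGenerator τ k j 0 = (∑ i, τ i ^ 2)⁻¹ * τ 0 := by
  have : 0 ≠ tailIndex k j := (lt_of_le_of_lt (Fin.zero_le k) (lt_tailIndex k j)).ne
  simp [normalGenerator, restrictVec_apply, acuteVertex_apply, this]

theorem inner_tangentGenerator {k : Fin (d + 1)} (j : Fin (d - k)) (x : 𝔼) :
    ⟪tangentGenerator τ k j, x⟫ = (τ (tailIndex k j))⁻¹ * x (tailIndex k j) -
      (∑ i ∈ Finset.Iic k, τ i ^ 2)⁻¹ * ∑ i ∈ Finset.Iic k, τ i * x i := by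
  rw [tangentGenerator, inner_sub_left, inner_acuteVertex, real_inner_smul_left, inner_restrictVec]

theorem inner_normalGenerator {k : Fin (d + 1)} (j : Fin (d - k)) (x : 𝔼) :
    ⟪normalGenerator τ k j, x⟫ = (∑ i, τ i ^ 2)⁻¹ * weightSum τ x -
      (τ (tailIndex k j))⁻¹ * x (tailIndex k j) := by
  rw [normalGenerator, inner_sub_left, inner_acuteVertex, real_inner_smul_left,
    inner_restrictVec_univ]

variable (hτ : ∀ i, 0 < τ i)
include hτ

theorem sum_Iic_sq_pos (k : Fin (d + 1)) : 0 < ∑ i ∈ Finset.Iic k, τ i ^ 2 :=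
  Finset.sum_pos (fun i _ => pow_pos (hτ i) 2) ⟨k, by simp⟩

theorem sum_univ_sq_pos : 0 < ∑ i, τ i ^ 2 :=
  Finset.sum_pos (fun i _ => pow_pos (hτ i) 2) ⟨0, by simp⟩

theorem weightSum_tangentGenerator {k : Fin (d + 1)} (j : Fin (d - k)) :
    weightSum τ (tangentGenerator τ k j) = 0 := by
  have h : weightSum τ (restrictVec τ (Finset.Iic k)) = ∑ i ∈ Finset.Iic k, τ i ^ 2 := by
    rw [← inner_restrictVec_univ, real_inner_comm, inner_restrictVec]
    simp [restrictVec_apply, sq]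
  rw [tangentGenerator, map_sub, map_smul, weightSum_acuteVertex hτ, h, smul_eq_mul,
    inv_mul_cancel₀ (sum_Iic_sq_pos hτ k).ne', sub_self]

theorem weightSum_normalGenerator {k : Fin (d + 1)} (j : Fin (d - k)) :
    weightSum τ (normalGenerator τ k j) = 0 := by
  rw [normalGenerator, map_sub, map_smul, weightSum_acuteVertex hτ, ← inner_restrictVec_univ,
    inner_restrictVec_self, smul_eq_mul, inv_mul_cancel₀ (sum_univ_sq_pos hτ).ne', sub_self]

theorem inner_tangentGenerator_tangentGenerator {k : Fin (d + 1)} (i j : Fin (d - k)) :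
    ⟪tangentGenerator τ k i, tangentGenerator τ k j⟫ =
      1 / (∑ i ∈ Finset.Iic k, τ i ^ 2) + if i = j then 1 / tailSq τ k i else 0 := by
  have hA := (sum_Iic_sq_pos hτ k).ne'
  have h : ∑ m ∈ Finset.Iic k, τ m * tangentGenerator τ k j m = -1 := by
    rw [← inner_restrictVec, tangentGenerator, inner_sub_right, real_inner_comm,
      inner_acuteVertex, restrictVec_apply, if_neg (by simpa using lt_tailIndex k j),
      real_inner_smul_right, inner_restrictVec_self, inv_mul_cancel₀ hA]
    ring
  rw [inner_tangentGenerator, h, tangentGenerator_tailIndex]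
  split_ifs with hij
  · subst hij
    rw [tailSq_eq]
    field_simp
    ring
  · ring

/-- With `B = ∑ τᵢ²`, the foot has squared norm `1 / B` and inner product `1 / B` with every vertex.
The sum `1 / B - 2 / B` produces the negative parameter. -/
theorem inner_normalGenerator_normalGenerator {k : Fin (d + 1)} (i j : Fin (d - k)) :
    ⟪normalGenerator τ k i, normalGenerator τ k j⟫ =
      1 / (-∑ i, τ i ^ 2) + if i = j then 1 / tailSq τ k i else 0 := by
  have hB := (sum_univ_sq_pos hτ).ne'
  have hi := (hτ (tailIndex k i)).ne'
  rw [inner_normalGenerator, weightSum_normalGenerator hτ]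
  simp only [normalGenerator, PiLp.sub_apply, PiLp.smul_apply, restrictVec_apply,
    acuteVertex_apply, Finset.mem_univ, if_true, tailIndex_inj, smul_eq_mul]
  split_ifs with hij
  · subst hij
    rw [tailSq_eq]
    field_simp
    ring
  · field_simp
    ring

theorem linearIndependent_tangentGenerator (k : Fin (d + 1)) :
    LinearIndependent ℝ (tangentGenerator τ k) := by
  rw [Fintype.linearIndependent_iff]
  intro g hg i
  have h := congrArg (fun x : 𝔼 => x (tailIndex k i)) hg
  simp only [sum_smul_tangentGenerator_tailIndex, PiLp.zero_apply] at h
  exact (mul_eq_zero.1 h).resolve_right (inv_ne_zero (hτ _).ne')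

/-- Coordinate `0` sees only the common foot, so the coefficients of a relation sum to zero; the
foot then cancels and independent vertices remain. -/
theorem linearIndependent_normalGenerator (k : Fin (d + 1)) :
    LinearIndependent ℝ (normalGenerator τ k) := by
  rw [Fintype.linearIndependent_iff]
  intro g hg i
  have h0 := congrArg (fun x : 𝔼 => x 0) hg
  simp only [WithLp.ofLp_sum, Finset.sum_apply, PiLp.smul_apply, smul_eq_mul,
    normalGenerator_zero, PiLp.zero_apply, ← Finset.sum_mul] at h0
  have hsum : ∑ j, g j = 0 := (mul_eq_zero.1 h0).resolve_right
    (mul_ne_zero (inv_ne_zero (sum_univ_sq_pos hτ).ne') (hτ 0).ne')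
  have h := congrArg (fun x : 𝔼 => x (tailIndex k i)) hg
  simp only [normalGenerator, smul_sub, Finset.sum_sub_distrib, ← Finset.sum_smul, hsum,
    zero_smul, zero_sub] at h
  have h' : g i * (τ (tailIndex k i))⁻¹ = 0 := by
    simpa [acuteVertex_apply, tailIndex_inj] using h
  exact (mul_eq_zero.1 h').resolve_right (inv_ne_zero (hτ _).ne')

/-- The pointed part of the tangent cone. -/
theorem isOrthocentricCone_tangent (k : Fin (d + 1)) :
    IsOrthocentricCone (∑ i ∈ Finset.Iic k, τ i ^ 2) (tailSq τ k) (fun _ => 1)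
      (PointedCone.hull ℝ (Set.range (tangentGenerator τ k))) := by
  refine ⟨(sum_Iic_sq_pos hτ k).ne', fun i => (pow_pos (hτ _) 2).ne', tangentGenerator τ k,
    linearIndependent_tangentGenerator hτ k, inner_tangentGenerator_tangentGenerator hτ, ?_⟩
  simp

theorem isOrthocentricCone_normal (k : Fin (d + 1)) :
    IsOrthocentricCone (-∑ i, τ i ^ 2) (tailSq τ k) (fun _ => 1)
      (PointedCone.hull ℝ (Set.range (normalGenerator τ k))) := by
  refine ⟨neg_ne_zero.2 (sum_univ_sq_pos hτ).ne', fun i => (pow_pos (hτ _) 2).ne',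
    normalGenerator τ k, linearIndependent_normalGenerator hτ k,
    inner_normalGenerator_normalGenerator hτ, ?_⟩
  simp

theorem salient_hull_tangentGenerator (k : Fin (d + 1)) :
    (PointedCone.hull ℝ (Set.range (tangentGenerator τ k)) : ConvexCone ℝ 𝔼).Salient := by
  have hnn : ∀ x ∈ PointedCone.hull ℝ (Set.range (tangentGenerator τ k)), ∀ j,
      0 ≤ x (tailIndex k j) := by
    intro x hx j
    obtain ⟨c, hc, rfl⟩ := PointedCone.mem_hull_range_iff.1 hx
    rw [sum_smul_tangentGenerator_tailIndex]
    exact mul_nonneg (hc j) (inv_pos.2 (hτ _)).le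
  intro x hx hx0 hnx
  obtain ⟨c, hc, hcx⟩ := PointedCone.mem_hull_range_iff.1 hx
  refine hx0 ?_
  rw [← hcx]
  refine Finset.sum_eq_zero fun j _ => ?_
  have h1 := hnn _ hnx j
  rw [← hcx, PiLp.neg_apply, sum_smul_tangentGenerator_tailIndex] at h1
  have h2 : c j ≤ 0 := by
    by_contra! h
    have := mul_pos h (inv_pos.2 (hτ (tailIndex k j)))
    linarith
  rw [le_antisymm h2 (hc j), zero_smul]

theorem inner_vectorSpan_hull_eq_zero (k : Fin (d + 1)) {x y : 𝔼}
    (hx : x ∈ vectorSpan ℝ (acuteFace τ k))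
    (hy : y ∈ PointedCone.hull ℝ (Set.range (tangentGenerator τ k))) : ⟪x, y⟫ = 0 := by
  obtain ⟨c, hc, rfl⟩ := PointedCone.mem_hull_range_iff.1 hy
  obtain ⟨h0, h1⟩ := (mem_vectorSpan_acuteFace_iff hτ).1 hx
  have h2 : ∑ i ∈ Finset.Iic k, τ i * x i = 0 := by
    rw [← h0, weightSum_apply]
    refine Finset.sum_subset (Finset.subset_univ _) fun i _ hi => ?_
    rw [h1 i (by simpa using hi), mul_zero]
  rw [inner_sum]
  refine Finset.sum_eq_zero fun j _ => ?_
  rw [real_inner_smul_right, real_inner_comm, inner_tangentGenerator, h2,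
    h1 _ (lt_tailIndex k j)]
  ring

theorem tangentConeOf_acuteFace_eq_add (k : Fin (d + 1)) :
    tangentConeOf (acuteFace τ k) (acuteSimplex τ) = (vectorSpan ℝ (acuteFace τ k) : Set 𝔼) +
      (PointedCone.hull ℝ (Set.range (tangentGenerator τ k)) : Set 𝔼) := by
  ext v
  rw [mem_tangentConeOf_acuteFace_iff hτ, forall_gt_iff_tailIndex, Set.mem_add]
  constructor
  · rintro ⟨h0, h1⟩
    -- The coefficients are chosen so that `y` and `v` agree in all coordinates beyond `k`.
    set y : 𝔼 := ∑ j, (τ (tailIndex k j) * v (tailIndex k j)) • tangentGenerator τ k j with hy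
    refine ⟨v - y, (mem_vectorSpan_acuteFace_iff hτ).2 ⟨?_, ?_⟩, y,
      PointedCone.mem_hull_range_iff.2 ⟨_, fun j => mul_nonneg (hτ _).le (h1 j), rfl⟩,
      sub_add_cancel v y⟩
    · simp [hy, h0, weightSum_tangentGenerator hτ]
    · rw [forall_gt_iff_tailIndex]
      intro j
      have := (hτ (tailIndex k j)).ne'
      rw [PiLp.sub_apply, hy, sum_smul_tangentGenerator_tailIndex]
      field_simp
      ring
  · rintro ⟨x, hx, y, hy, rfl⟩
    obtain ⟨c, hc, rfl⟩ := PointedCone.mem_hull_range_iff.1 hy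
    obtain ⟨h0, h1⟩ := (mem_vectorSpan_acuteFace_iff hτ).1 hx
    refine ⟨by simp [h0, weightSum_tangentGenerator hτ], fun j => ?_⟩
    rw [PiLp.add_apply, h1 _ (lt_tailIndex k j), sum_smul_tangentGenerator_tailIndex, zero_add]
    exact mul_nonneg (hc j) (inv_pos.2 (hτ _)).le

theorem inner_span_restrictVec_hull_eq_zero (k : Fin (d + 1)) {x y : 𝔼}
    (hx : x ∈ Submodule.span ℝ {restrictVec τ Finset.univ})
    (hy : y ∈ PointedCone.hull ℝ (Set.range (normalGenerator τ k))) : ⟪x, y⟫ = 0 := by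
  obtain ⟨a, rfl⟩ := Submodule.mem_span_singleton.1 hx
  obtain ⟨c, hc, rfl⟩ := PointedCone.mem_hull_range_iff.1 hy
  rw [real_inner_smul_left, inner_restrictVec_univ]
  simp [weightSum_normalGenerator hτ]

theorem finrank_span_restrictVec :
    Module.finrank ℝ (Submodule.span ℝ {restrictVec τ Finset.univ}) = 1 := by
  refine finrank_span_singleton fun h => (hτ 0).ne' ?_
  simpa [restrictVec_apply] using congrArg (fun x : 𝔼 => x 0) h

theorem normalConeOf_acuteFace_eq_add (k : Fin (d + 1)) :
    normalConeOf (acuteFace τ k) (acuteSimplex τ) =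
      (Submodule.span ℝ {restrictVec τ Finset.univ} : Set 𝔼) +
        (PointedCone.hull ℝ (Set.range (normalGenerator τ k)) : Set 𝔼) := by
  have hB := (sum_univ_sq_pos hτ).ne'
  ext x
  rw [Set.mem_add]
  constructor
  · intro hx
    obtain ⟨h0, h1⟩ := (mem_normalConeOf_acuteFace_iff hτ).1 hx
    rw [forall_gt_iff_tailIndex] at h1
    set a := (τ 0)⁻¹ * x 0 with ha
    -- After the feet are absorbed into the line, its total coefficient must be `a`, by coordinate
    -- `0`. Coordinate `m > k` then reads `x_m = τ_m a - c_m / τ_m`, which determines `c`.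
    set c : Fin (d - k) → ℝ := fun j => τ (tailIndex k j) ^ 2 *
      (a - (τ (tailIndex k j))⁻¹ * x (tailIndex k j)) with hc
    refine ⟨(a - (∑ j, c j) * (∑ i, τ i ^ 2)⁻¹) • restrictVec τ Finset.univ,
      Submodule.smul_mem _ _ (Submodule.mem_span_singleton_self _),
      ∑ j, c j • normalGenerator τ k j,
      PointedCone.mem_hull_range_iff.2 ⟨c, fun j => mul_nonneg (sq_nonneg _)
        (sub_nonneg.2 (h1 j)), rfl⟩, ?_⟩
    have hsum : ∑ j, c j • normalGenerator τ k j =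
        ((∑ j, c j) * (∑ i, τ i ^ 2)⁻¹) • restrictVec τ Finset.univ -
          ∑ j, c j • acuteVertex τ (tailIndex k j) := by
      simp only [normalGenerator, smul_sub, Finset.sum_sub_distrib, ← Finset.sum_smul, smul_smul,
        Finset.sum_mul]
    rw [hsum, sub_smul, sub_add_sub_cancel]
    ext i
    have hi := (hτ i).ne'
    rcases le_or_gt i k with hik | hik
    · have hne : ∀ j, i ≠ tailIndex k j := fun j => (lt_of_le_of_lt hik (lt_tailIndex k j)).ne
      have := h0 i hik
      simp only [PiLp.sub_apply, PiLp.smul_apply, restrictVec_apply, Finset.mem_univ, if_true,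
        WithLp.ofLp_sum, Finset.sum_apply, acuteVertex_apply, hne, if_false, smul_eq_mul, mul_zero,
        Finset.sum_const_zero, sub_zero]
      rw [← this]
      field_simp
    · obtain ⟨m, rfl⟩ := exists_tailIndex_eq hik
      simp only [PiLp.sub_apply, PiLp.smul_apply, restrictVec_apply, Finset.mem_univ, if_true,
        WithLp.ofLp_sum, Finset.sum_apply, acuteVertex_apply, tailIndex_inj, smul_eq_mul, mul_ite,
        mul_zero, Finset.sum_ite_eq, hc]
      field_simp
      ring
  · rintro ⟨x, hx, y, hy, rfl⟩ v hv
    obtain ⟨a, rfl⟩ := Submodule.mem_span_singleton.1 hx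
    obtain ⟨c, hc, rfl⟩ := PointedCone.mem_hull_range_iff.1 hy
    obtain ⟨h0, h1⟩ := (mem_tangentConeOf_acuteFace_iff hτ).1 hv
    rw [inner_add_left, real_inner_smul_left, inner_restrictVec_univ, h0, mul_zero, zero_add,
      sum_inner]
    refine Finset.sum_nonpos fun j _ => ?_
    rw [real_inner_smul_left, inner_normalGenerator, h0, mul_zero, zero_sub]
    have := mul_nonneg (inv_pos.2 (hτ (tailIndex k j))).le (h1 _ (lt_tailIndex k j))
    exact mul_nonpos_of_nonneg_of_nonpos (hc j) (by linarith)

theorem normalConeOf_acuteFace_of_eq {k : Fin (d + 1)} (hk : (k : ℕ) = d) :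
    normalConeOf (acuteFace τ k) (acuteSimplex τ) =
      (Submodule.span ℝ {restrictVec τ Finset.univ} : Set 𝔼) := by
  have : IsEmpty (Fin (d - k)) := by
    rw [hk, Nat.sub_self]
    infer_instance
  rw [normalConeOf_acuteFace_eq_add hτ, Set.range_eq_empty, PointedCone.hull, Submodule.span_empty,
    Submodule.bot_coe, Set.add_singleton]
  simp

theorem mem_span_tangentConeOf_iff {k : Fin (d + 1)} {x : 𝔼} :
    x ∈ Submodule.span ℝ (tangentConeOf (acuteFace τ k) (acuteSimplex τ)) ↔
      weightSum τ x = 0 := by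
  constructor
  · intro hx
    have hle : Submodule.span ℝ (tangentConeOf (acuteFace τ k) (acuteSimplex τ)) ≤
        (weightSum τ).ker :=
      Submodule.span_le.2 fun v hv => ((mem_tangentConeOf_acuteFace_iff hτ).1 hv).1
    exact hle hx
  · intro hx
    rw [← sum_smul_acuteVertex_sub hτ hx]
    refine Submodule.sum_mem _ fun i _ => Submodule.smul_mem _ _ (Submodule.subset_span ?_)
    refine (mem_tangentConeOf_acuteFace_iff hτ).2
      ⟨by simp [weightSum_acuteVertex hτ], fun j hj => ?_⟩
    have hj0 : j ≠ 0 := (lt_of_le_of_lt (Fin.zero_le k) hj).ne'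
    have := (inv_pos.2 (hτ i)).le
    simp only [PiLp.sub_apply, acuteVertex_apply, hj0, if_false, sub_zero]
    split_ifs
    · exact this
    · exact le_rfl

/-- On the hyperplane `weightSum τ x = 0` the pairing with a normal generator is `-xⱼ / τⱼ`, so the
normal generators cut out the tangent cone. -/
theorem internalAngle_acuteFace (k : Fin (d + 1)) :
    internalAngle (acuteFace τ k) (acuteSimplex τ) =
      orthoG (-∑ i, τ i ^ 2) (tailSq τ k) (fun _ => 1) := by
  refine solidAngle_eq_orthoG (u := normalGenerator τ k)
    (fun j => (mem_span_tangentConeOf_iff hτ).2 (weightSum_normalGenerator hτ j))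
    (inner_normalGenerator_normalGenerator hτ) fun x hx => ?_
  rw [mem_span_tangentConeOf_iff hτ] at hx
  rw [mem_tangentConeOf_acuteFace_iff hτ, forall_gt_iff_tailIndex]
  simp only [hx, true_and]
  refine forall_congr' fun j => ?_
  rw [inner_normalGenerator, hx, mul_zero, zero_sub, neg_nonpos,
    mul_nonneg_iff_of_pos_left (inv_pos.2 (hτ _))]

/-- Both the negative of a vertex beyond the face and the vector `restrictVec τ (Finset.Iic k)`
belong to the normal cone. -/
theorem tangentGenerator_mem_span_normalConeOf {k : Fin (d + 1)} (j : Fin (d - k)) :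
    tangentGenerator τ k j ∈
      Submodule.span ℝ (normalConeOf (acuteFace τ k) (acuteSimplex τ)) := by
  have hinv : ∀ i, (τ i)⁻¹ * τ i = 1 := fun i => inv_mul_cancel₀ (hτ i).ne'
  refine Submodule.sub_mem _ (neg_mem_iff.1 (Submodule.subset_span ?_))
    (Submodule.smul_mem _ _ (Submodule.subset_span ?_))
  · rw [mem_normalConeOf_acuteFace_iff hτ]
    have h0 : ∀ i ≤ k, acuteVertex τ (tailIndex k j) i = 0 := fun i hi => by
      rw [acuteVertex_apply, if_neg (lt_of_le_of_lt hi (lt_tailIndex k j)).ne]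
    refine ⟨fun i hi => by simp [h0 i hi, h0 0 (Fin.zero_le k)], fun i hi => ?_⟩
    have := (inv_pos.2 (hτ i)).le
    have := (inv_pos.2 (hτ (tailIndex k j))).le
    rw [PiLp.neg_apply, PiLp.neg_apply, h0 0 (Fin.zero_le k), acuteVertex_apply, neg_zero, mul_zero,
      mul_neg, neg_nonpos]
    split_ifs <;> positivity
  · rw [mem_normalConeOf_acuteFace_iff hτ]
    refine ⟨fun i hi => by simp [restrictVec_apply, hi, hinv], fun i hi => ?_⟩
    simp [restrictVec_apply, not_le.2 hi, hinv]

theorem eq_of_mem_span_normalConeOf {k : Fin (d + 1)} {x : 𝔼}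
    (hx : x ∈ Submodule.span ℝ (normalConeOf (acuteFace τ k) (acuteSimplex τ)))
    {i : Fin (d + 1)} (hi : i ≤ k) : (τ i)⁻¹ * x i = (τ 0)⁻¹ * x 0 := by
  induction hx using Submodule.span_induction with
  | mem x hx => exact ((mem_normalConeOf_acuteFace_iff hτ).1 hx).1 i hi
  | zero => simp
  | add x y _ _ hx hy => simp only [PiLp.add_apply, mul_add, hx, hy]
  | smul a x _ hx => simp only [PiLp.smul_apply, smul_eq_mul, mul_left_comm _ a, hx]

/-- On the linear hull of the normal cone the ratios `xᵢ / τᵢ`, `i ≤ k`, have a common value, which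
is the pairing of `x` with the foot. Pairing with a tangent generator thus gives `xⱼ / τⱼ - x₀ /
τ₀`, the remaining inequality of the normal cone. -/
theorem externalAngle_acuteFace (k : Fin (d + 1)) :
    externalAngle (acuteFace τ k) (acuteSimplex τ) =
      orthoG (∑ i ∈ Finset.Iic k, τ i ^ 2) (tailSq τ k) (fun _ => 1) := by
  refine solidAngle_eq_orthoG (u := tangentGenerator τ k)
    (tangentGenerator_mem_span_normalConeOf hτ)
    (inner_tangentGenerator_tangentGenerator hτ) fun x hx => ?_
  have hA := (sum_Iic_sq_pos hτ k).ne'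
  have h0 : ∀ i ≤ k, (τ i)⁻¹ * x i = (τ 0)⁻¹ * x 0 := fun i => eq_of_mem_span_normalConeOf hτ hx
  have hsum : ∑ i ∈ Finset.Iic k, τ i * x i =
      (∑ i ∈ Finset.Iic k, τ i ^ 2) * ((τ 0)⁻¹ * x 0) := by
    rw [Finset.sum_mul]
    refine Finset.sum_congr rfl fun i hi => ?_
    have := (hτ i).ne'
    rw [← h0 i (Finset.mem_Iic.1 hi)]
    field_simp
  rw [mem_normalConeOf_acuteFace_iff hτ, forall_gt_iff_tailIndex, and_iff_right h0]
  refine forall_congr' fun j => ?_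
  rw [inner_tangentGenerator, hsum, inv_mul_cancel_left₀ hA, sub_nonpos]

end SimplexCones

end

theorem theorem1p3 {d : ℕ} (hd : 2 ≤ d) (τ : Fin (d + 1) → ℝ) (hτ : ∀ i, 0 < τ i)
    (k : Fin (d + 1)) :
    -- the tangent cone, `k < d`
    ((k : ℕ) < d →
      ∃ (L : Submodule ℝ (EuclideanSpace ℝ (Fin (d + 1))))
        (D : PointedCone ℝ (EuclideanSpace ℝ (Fin (d + 1)))),
        L = vectorSpan ℝ (acuteFace τ k) ∧
        Module.finrank ℝ L = k ∧
        (∀ x, x ∈ L ↔ x ∈ tangentConeOf (acuteFace τ k) (acuteSimplex τ) ∧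
          -x ∈ tangentConeOf (acuteFace τ k) (acuteSimplex τ)) ∧
        (D : ConvexCone ℝ (EuclideanSpace ℝ (Fin (d + 1)))).Salient ∧
        IsOrthocentricCone (∑ i ∈ Finset.Iic k, τ i ^ 2) (tailSq τ k) (fun _ => 1) D ∧
        (∀ x ∈ L, ∀ y ∈ D, ⟪x, y⟫ = 0) ∧
        tangentConeOf (acuteFace τ k) (acuteSimplex τ) =
          (L : Set (EuclideanSpace ℝ (Fin (d + 1)))) +
            (D : Set (EuclideanSpace ℝ (Fin (d + 1))))) ∧
    -- the tangent cone, `k = d`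
    ((k : ℕ) = d →
      tangentConeOf (acuteFace τ k) (acuteSimplex τ) = vectorSpan ℝ (acuteSimplex τ)) ∧
    -- the normal cone, `k < d`
    ((k : ℕ) < d →
      ∃ (M : Submodule ℝ (EuclideanSpace ℝ (Fin (d + 1))))
        (D : PointedCone ℝ (EuclideanSpace ℝ (Fin (d + 1)))),
        Module.finrank ℝ M = 1 ∧
        IsOrthocentricCone (-∑ i, τ i ^ 2) (tailSq τ k) (fun _ => 1) D ∧
        (∀ x ∈ M, ∀ y ∈ D, ⟪x, y⟫ = 0) ∧
        normalConeOf (acuteFace τ k) (acuteSimplex τ) =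
          (M : Set (EuclideanSpace ℝ (Fin (d + 1)))) +
            (D : Set (EuclideanSpace ℝ (Fin (d + 1))))) ∧
    -- the normal cone, `k = d`
    ((k : ℕ) = d →
      ∃ M : Submodule ℝ (EuclideanSpace ℝ (Fin (d + 1))),
        Module.finrank ℝ M = 1 ∧
        normalConeOf (acuteFace τ k) (acuteSimplex τ) =
          (M : Set (EuclideanSpace ℝ (Fin (d + 1))))) ∧
    -- the internal and the external angle
    internalAngle (acuteFace τ k) (acuteSimplex τ) =
      orthoG (-∑ i, τ i ^ 2) (tailSq τ k) (fun _ => 1) ∧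
    externalAngle (acuteFace τ k) (acuteSimplex τ) =
      orthoG (∑ i ∈ Finset.Iic k, τ i ^ 2) (tailSq τ k) (fun _ => 1) ∧
    -- the explicit formula for `g`
    (∀ (n : ℕ) (l₀ : ℝ) (l : Fin n → ℝ), (∀ j, 0 < l j) → (0 < l₀ ∨ l₀ < -∑ j, l j) →
      Integrable (phiIntegrand l₀ l) ∧
      (orthoG l₀ l (fun _ => 1) : ℂ) =
        1 / (Real.sqrt (2 * Real.pi) : ℂ) * ∫ x : ℝ, phiIntegrand l₀ l x) := by
  refine ⟨fun _ => ⟨vectorSpan ℝ (acuteFace τ k),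
    PointedCone.hull ℝ (Set.range (tangentGenerator τ k)), rfl,
    finrank_vectorSpan_acuteFace hτ k, fun x => ?_, salient_hull_tangentGenerator hτ k,
    isOrthocentricCone_tangent hτ k, fun x hx y hy => inner_vectorSpan_hull_eq_zero hτ k hx hy,
    tangentConeOf_acuteFace_eq_add hτ k⟩, fun hk => ?_,
    fun _ => ⟨Submodule.span ℝ {restrictVec τ Finset.univ},
      PointedCone.hull ℝ (Set.range (normalGenerator τ k)), finrank_span_restrictVec hτ,
      isOrthocentricCone_normal hτ k,
      fun x hx y hy => inner_span_restrictVec_hull_eq_zero hτ k hx hy,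
      normalConeOf_acuteFace_eq_add hτ k⟩,
    fun hk => ⟨Submodule.span ℝ {restrictVec τ Finset.univ}, finrank_span_restrictVec hτ,
      normalConeOf_acuteFace_of_eq hτ hk⟩,
    internalAngle_acuteFace hτ k, externalAngle_acuteFace hτ k,
    fun n l₀ l hl h₀ => integrable_phiIntegrand_and_orthoG_eq hl h₀⟩
  · rw [mem_vectorSpan_acuteFace_iff hτ, mem_tangentConeOf_acuteFace_iff hτ,
      mem_tangentConeOf_acuteFace_iff hτ]
    constructor
    · rintro ⟨h0, h1⟩
      exact ⟨⟨h0, fun i hi => (h1 i hi).ge⟩, by simp [h0], fun i hi => by simp [h1 i hi]⟩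
    · rintro ⟨⟨h0, h1⟩, _, h2⟩
      refine ⟨h0, fun i hi => le_antisymm ?_ (h1 i hi)⟩
      simpa using h2 i hi
  · have hlast : ∀ i, ¬ k < i := fun i hi => by
      rw [Fin.lt_def] at hi
      omega
    have hface : acuteFace τ k = acuteSimplex τ := by
      rw [acuteFace, acuteSimplex, ← Set.image_univ]
      congr 2
      exact Set.eq_univ_of_forall fun i => not_lt.1 (hlast i)
    ext v
    rw [mem_tangentConeOf_acuteFace_iff hτ, ← hface, SetLike.mem_coe,
      mem_vectorSpan_acuteFace_iff hτ]
    simp [hlast]
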